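/- **Proposition 4.6.** Let $d\ge 1$ and $T>0$. Let $V_1:\mathbb R^d\to[0,\infty)$ be bounded and continuous, $C^1$ on $\mathbb R^d\setminus\{0\}$, even, with $\int V_1\,dx=1$, $\int|x|V_1(x)\,dx<\infty$, $\nabla V_1\in L^1(\mathbb R^d)$ and $|\nabla V_1(x)|\le C(1+|x|)$ for $x\ne0$ and some constant $C$. Put $W_1=V_1*V_1$ and, for $\varepsilon>0$, $V_\varepsilon(x)=\varepsilon^{-d}V_1(x/\varepsilon)$, $W_\varepsilon(x)=\varepsilon^{-d}W_1(x/\varepsilon)$. Let $\mathcal P_2(\mathbb R^d)$ be the set of Borel probability measures on $\mathbb R^d$ with finite second moment, $d_W$ the $2$-Wasserstein distance, and $\mathcal W_\varepsilon[\rho]=\frac12\int (W_\varepsilon*\rho)\,d\rho$. Let $\rho_0\in\mathcal P_2(\mathbb R^d)$ be absolutely continuous with density (still denoted $\rho_0$) in $L^2(\mathbb R^d)$ and with finite entropy, $\rho_0\log\rho_0\in L^1(\mathbb R^d)$. For every $\varepsilon\in(0,1]$ let $(\rho^\varepsilon_t)_{t\in[0,T]}$ be a limit of the minimising movement scheme for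 $\mathcal W_\varepsilon$ started at $\rho_0$: there are time steps $\tau_j>0$, $\tau_j\to0$, and sequences $(\rho^n_{\tau_j,\varepsilon})_{n\ge0}$ with $\rho^0_{\tau_j,\varepsilon}=\rho_0$ and $$\rho^{n+1}_{\tau_j,\varepsilon}\in\operatorname*{argmin}_{\rho\in\mathcal P_2(\mathbb R^d)}\Big\{\frac{d_W^2(\rho^n_{\tau_j,\varepsilon},\rho)}{2\tau_j}+\mathcal W_\varepsilon[\rho]\Big\},$$ such that for every $t\in[0,T]$ the piecewise constant interpolations (equal to $\rho^n_{\tau_j,\varepsilon}$ on $((n-1)\tau_j,n\tau_j]$, and to $\rho_0$ at $t=0$) converge narrowly to $\rho^\varepsilon_t$ as $j\to\infty$. Set $v^\varepsilon(t)=V_\varepsilon*\rho^\varepsilon_t$. Let $(\varepsilon_k)_k$ be a sequence in $(0,1]$ such that $v^{\varepsilon_k}\in L^2([0,T];H^1(\mathbb R^d))$ for all $k$ and $v^{\varepsilon_k}\rightharpoonup v$ weakly in $L^2([0,T];H^1(\mathbb R^d))$ for some $v\in L^2([0,T];H^1(\mathbb R^d))$. Then $v^{\varepsilon_k}\to v$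 strongly in $L^2([0,T];L^2(\mathbb R^d))$. -/

import Mathlib

open MeasureTheory Filter Topology Set
open scoped ENNReal ContDiff

noncomputable section

/-- Euclidean space `ℝ^d`. -/
abbrev Rd (d : ℕ) : Type := EuclideanSpace ℝ (Fin d)

/-! ### Probability measures, moments, and the 2-Wasserstein distance -/

/-- `P₂(ℝ^d)`: Borel probability measures with finite second moment. -/
def P2 (d : ℕ) : Set (ProbabilityMeasure (Rd d)) :=
  {μ | ∫⁻ x, ‖x‖ₑ ^ 2 ∂(μ : Measure (Rd d)) < ⊤}

/-- The transport plans between `μ` and `ν`. -/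
def transportPlans {d : ℕ} (μ ν : ProbabilityMeasure (Rd d)) : Set (Measure (Rd d × Rd d)) :=
  {γ | γ.map Prod.fst = (μ : Measure (Rd d)) ∧ γ.map Prod.snd = (ν : Measure (Rd d))}

/-- The squared 2-Wasserstein distance (finite on `P2 d`). -/
def wassersteinSq {d : ℕ} (μ ν : ProbabilityMeasure (Rd d)) : ℝ≥0∞ :=
  ⨅ γ ∈ transportPlans μ ν, ∫⁻ p, ‖p.1 - p.2‖ₑ ^ 2 ∂γ

/-! ### Kernels -/

/-- The standing assumption on the kernel `V₁`. The gradient is the classical one, which is only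
used off the origin (a null set when `d ≥ 1`). -/
structure AdmissibleKernel {d : ℕ} (V : Rd d → ℝ) : Prop where
  nonneg : ∀ x, 0 ≤ V x
  continuous : Continuous V
  bounded : ∃ B : ℝ, ∀ x, V x ≤ B
  contDiffOn : ContDiffOn ℝ 1 V {0}ᶜ
  integrable : Integrable V
  integral_eq_one : ∫ x, V x = 1
  even : ∀ x, V (-x) = V x
  integrable_moment : Integrable fun x => ‖x‖ * V x
  integrable_gradient : Integrable (gradient V)
  gradient_growth : ∃ C : ℝ, ∀ x, x ≠ 0 → ‖gradient V x‖ ≤ C * (1 + ‖x‖)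

/-- The rescaling `K_ε(x) = ε^{-d} K(x / ε)`. -/
def rescale {d : ℕ} (K : Rd d → ℝ) (ε : ℝ) (x : Rd d) : ℝ :=
  (ε ^ d)⁻¹ * K (ε⁻¹ • x)

/-- The interaction kernel `W₁ = V₁ * V₁`. -/
def interactionKernel {d : ℕ} (V : Rd d → ℝ) : Rd d → ℝ :=
  convolution V V (ContinuousLinearMap.mul ℝ ℝ) volume

/-- Convolution of a function with a probability measure, `(K * ρ)(x) = ∫ K(x - y) dρ(y)`. -/
def convMeasure {d : ℕ} (K : Rd d → ℝ) (ρ : ProbabilityMeasure (Rd d)) (x : Rd d) : ℝ :=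
  ∫ y, K (x - y) ∂(ρ : Measure (Rd d))

/-- The interaction energy `𝓦_ε[ρ] = ½ ∫ (W_ε * ρ) dρ`, with `W_ε(x) = ε^{-d} W₁(x / ε)`. -/
def interactionEnergy {d : ℕ} (V : Rd d → ℝ) (ε : ℝ) (ρ : ProbabilityMeasure (Rd d)) : ℝ :=
  (1 / 2) * ∫ x, convMeasure (rescale (interactionKernel V) ε) ρ x ∂(ρ : Measure (Rd d))

/-! ### The minimising movement (JKO) scheme -/

/-- The functional minimised in one step of size `τ` starting from `μ`. -/
def jkoFunctional {d : ℕ} (V : Rd d → ℝ) (ε τ : ℝ) (μ ν : ProbabilityMeasure (Rd d)) : ℝ :=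
  (wassersteinSq μ ν).toReal / (2 * τ) + interactionEnergy V ε ν

/-- `r` is a sequence generated by the scheme with time step `τ` and initial value `ρ₀`. -/
def IsJKOSequence {d : ℕ} (V : Rd d → ℝ) (ε τ : ℝ) (ρ₀ : ProbabilityMeasure (Rd d))
    (r : ℕ → ProbabilityMeasure (Rd d)) : Prop :=
  r 0 = ρ₀ ∧
    ∀ n, r (n + 1) ∈ P2 d ∧ IsMinOn (jkoFunctional V ε τ (r n)) (P2 d) (r (n + 1))

/-- The piecewise constant interpolation: `r n` on `((n - 1) τ, n τ]`, and `r 0` at time `0`. -/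
def jkoInterpolation {d : ℕ} (τ : ℝ) (r : ℕ → ProbabilityMeasure (Rd d)) (t : ℝ) :
    ProbabilityMeasure (Rd d) :=
  r ⌈t / τ⌉₊

/-- The curve `ρ` on `[0,T]` is a limit of the scheme: along some sequence of time steps `τ_j → 0`,
the interpolations converge narrowly to `ρ t` for all `t ∈ [0,T]` (the topology of
`ProbabilityMeasure` is that of narrow convergence). -/
def IsJKOLimit {d : ℕ} (V : Rd d → ℝ) (ε T : ℝ) (ρ₀ : ProbabilityMeasure (Rd d))
    (ρ : ℝ → ProbabilityMeasure (Rd d)) : Prop :=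
  ∃ (τ : ℕ → ℝ) (r : ℕ → ℕ → ProbabilityMeasure (Rd d)),
    (∀ j, 0 < τ j) ∧ Tendsto τ atTop (𝓝 0) ∧
    (∀ j, IsJKOSequence V ε (τ j) ρ₀ (r j)) ∧
    ∀ t ∈ Icc 0 T, Tendsto (fun j => jkoInterpolation (τ j) (r j) t) atTop (𝓝 (ρ t))

/-- The assumptions on the initial datum: `ρ₀` is in `P₂(ℝ^d)`, is absolutely continuous with
density `f` in `L²`, and its entropy `∫ f log f` is finite. -/
structure AdmissibleDatum {d : ℕ} (ρ₀ : ProbabilityMeasure (Rd d)) : Prop where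
  mem_P2 : ρ₀ ∈ P2 d
  absolutelyContinuous : (ρ₀ : Measure (Rd d)) ≪ volume
  density_memLp : MemLp (fun x => ((ρ₀ : Measure (Rd d)).rnDeriv volume x).toReal) 2 volume
  entropy_finite : Integrable fun x =>
    ((ρ₀ : Measure (Rd d)).rnDeriv volume x).toReal *
      Real.log ((ρ₀ : Measure (Rd d)).rnDeriv volume x).toReal

/-! ### The Sobolev space `H¹(ℝ^d)` and Bochner spaces -/

/-- `L²(ℝ^d)`. -/
abbrev L2Rd (d : ℕ) : Type := Lp ℝ 2 (volume : Measure (Rd d))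

/-- `L²(ℝ^d; ℝ^d)`. -/
abbrev L2RdVec (d : ℕ) : Type := Lp (Rd d) 2 (volume : Measure (Rd d))

/-- `g` is the weak gradient of `u`. -/
def HasWeakGradient {d : ℕ} (u : L2Rd d) (g : L2RdVec d) : Prop :=
  ∀ φ : Rd d → ℝ, ContDiff ℝ ∞ φ → HasCompactSupport φ → ∀ e : Rd d,
    ∫ x, u x * fderiv ℝ φ x e = - ∫ x, inner ℝ (g x) e * φ x

theorem integrable_mul_fderiv_test {d : ℕ} (u : L2Rd d) {φ : Rd d → ℝ} (hφ : ContDiff ℝ ∞ φ)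
    (hc : HasCompactSupport φ) (e : Rd d) : Integrable fun x => u x * fderiv ℝ φ x e := by
  have h1 : MemLp (fun x => fderiv ℝ φ x e) 2 (volume : Measure (Rd d)) :=
    ((hφ.continuous_fderiv (by simp)).clm_apply continuous_const).memLp_of_hasCompactSupport
      (hc.fderiv_apply (𝕜 := ℝ) e)
  exact MemLp.integrable_mul (p := 2) (q := 2) (Lp.memLp u) h1

theorem integrable_inner_mul_test {d : ℕ} (g : L2RdVec d) {φ : Rd d → ℝ} (hφ : ContDiff ℝ ∞ φ)
    (hc : HasCompactSupport φ) (e : Rd d) : Integrable fun x => inner ℝ (g x) e * φ x :=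
  MemLp.integrable_mul (p := 2) (q := 2) ((Lp.memLp g).inner_const (𝕜 := ℝ) e)
    (hφ.continuous.memLp_of_hasCompactSupport hc)

/-- `H¹(ℝ^d)`, realised as the space of pairs `(u, ∇u)` in `L² × L²`, with the Hilbert norm
`‖u‖²_{H¹} = ‖u‖²_{L²} + ‖∇u‖²_{L²}`. -/
def H1 (d : ℕ) : Submodule ℝ (WithLp 2 (L2Rd d × L2RdVec d)) where
  carrier := {p | HasWeakGradient p.fst p.snd}
  zero_mem' := by
    intro φ _ _ e
    have h1 : (fun x => (0 : L2Rd d) x * fderiv ℝ φ x e) =ᵐ[volume] fun _ => (0 : ℝ) := by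
      filter_upwards [Lp.coeFn_zero ℝ 2 (volume : Measure (Rd d))] with x hx
      rw [hx]
      simp
    have h2 : (fun x => inner ℝ ((0 : L2RdVec d) x) e * φ x) =ᵐ[volume] fun _ => (0 : ℝ) := by
      filter_upwards [Lp.coeFn_zero (Rd d) 2 (volume : Measure (Rd d))] with x hx
      rw [hx]
      simp
    simp only [WithLp.zero_fst, WithLp.zero_snd]
    rw [integral_congr_ae h1, integral_congr_ae h2]
    simp
  add_mem' := by
    intro p q hp hq φ hφ hc e
    have h1 : (fun x => (p.fst + q.fst) x * fderiv ℝ φ x e) =ᵐ[volume]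
        fun x => p.fst x * fderiv ℝ φ x e + q.fst x * fderiv ℝ φ x e := by
      filter_upwards [Lp.coeFn_add p.fst q.fst] with x hx
      rw [hx, Pi.add_apply, add_mul]
    have h2 : (fun x => inner ℝ ((p.snd + q.snd) x) e * φ x) =ᵐ[volume]
        fun x => inner ℝ (p.snd x) e * φ x + inner ℝ (q.snd x) e * φ x := by
      filter_upwards [Lp.coeFn_add p.snd q.snd] with x hx
      rw [hx, Pi.add_apply, inner_add_left, add_mul]
    simp only [WithLp.add_fst, WithLp.add_snd]
    rw [integral_congr_ae h1, integral_congr_ae h2,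
      integral_add (integrable_mul_fderiv_test _ hφ hc e) (integrable_mul_fderiv_test _ hφ hc e),
      integral_add (integrable_inner_mul_test _ hφ hc e) (integrable_inner_mul_test _ hφ hc e),
      hp φ hφ hc e, hq φ hφ hc e]
    ring
  smul_mem' := by
    intro c p hp φ hφ hc e
    have h1 : (fun x => (c • p.fst) x * fderiv ℝ φ x e) =ᵐ[volume]
        fun x => c * (p.fst x * fderiv ℝ φ x e) := by
      filter_upwards [Lp.coeFn_smul c p.fst] with x hx
      rw [hx, Pi.smul_apply, smul_eq_mul, mul_assoc]
    have h2 : (fun x => inner ℝ ((c • p.snd) x) e * φ x) =ᵐ[volume]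
        fun x => c * (inner ℝ (p.snd x) e * φ x) := by
      filter_upwards [Lp.coeFn_smul c p.snd] with x hx
      rw [hx, Pi.smul_apply, real_inner_smul_left, mul_assoc]
    simp only [WithLp.smul_fst, WithLp.smul_snd]
    rw [integral_congr_ae h1, integral_congr_ae h2, integral_const_mul, integral_const_mul,
      hp φ hφ hc e]
    ring

/-- The embedding `H¹(ℝ^d) → L²(ℝ^d)`, `(u, ∇u) ↦ u`. -/
def H1.toL2 (d : ℕ) : H1 d →L[ℝ] L2Rd d :=
  (WithLp.fstL 2 ℝ (L2Rd d) (L2RdVec d)).comp (H1 d).subtypeL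

/-- `L²([0,T]; X)` for a Banach space `X` (Bochner space, Lebesgue measure in time). -/
abbrev L2Time (T : ℝ) (X : Type) [NormedAddCommGroup X] : Type :=
  Lp X 2 ((volume : Measure ℝ).restrict (Icc 0 T))

/-- The embedding `L²([0,T]; H¹(ℝ^d)) → L²([0,T]; L²(ℝ^d))`. -/
def L2Time.toL2 (d : ℕ) (T : ℝ) : L2Time T (H1 d) →L[ℝ] L2Time T (L2Rd d) :=
  (H1.toL2 d).compLpL 2 ((volume : Measure ℝ).restrict (Icc 0 T))

/-- The element `u` of `L²([0,T]; H¹(ℝ^d))` is the class of the function `w(t)(x)`: for almost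
every `t ∈ [0,T]`, `u(t) = w(t)` almost everywhere on `ℝ^d`. -/
def L2Time.IsClassOf {d : ℕ} {T : ℝ} (u : L2Time T (H1 d)) (w : ℝ → Rd d → ℝ) : Prop :=
  ∀ᵐ t ∂((volume : Measure ℝ).restrict (Icc 0 T)), ∀ᵐ x ∂(volume : Measure (Rd d)),
    (H1.toL2 d (u t)) x = w t x

/-- Weak convergence of a sequence in a normed space: tested against all continuous linear
functionals. -/
def WeaklyConvergesTo {X : Type} [NormedAddCommGroup X] [NormedSpace ℝ X] (u : ℕ → X) (v : X) :
    Prop :=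
  ∀ l : X →L[ℝ] ℝ, Tendsto (fun k => l (u k)) atTop (𝓝 (l v))

end

/-! Since the weak limit determines any strong limit, it is enough to show that the sequence is
Cauchy in `L²([0,T]; L²)`. The gradient bound controls small spatial scales, the metric structure of
the scheme controls time, and moments control infinity.

For a difference `u` of two terms at a fixed time and a mollifier `η` of radius `δ`, the translation
estimate for `H¹` functions gives `‖u‖² ≤ δ ‖∇u‖ ‖u‖ + ∫ |u| |η * u|`
(`HasWeakGradient.norm_sq_le_mollify`). After integration in time, the first term is small with `δ`,
because weakly convergent sequences are bounded.

For fixed `η`, the functions `η * v^ε(t)` are Lipschitz in `x` and `1/2`-Hölder in `t`, uniformly in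
`ε`. The Hölder bound holds because each step of the scheme pays for its squared Wasserstein
displacement with energy, the initial energy is bounded in `ε` as the density is in `L²`, and `d_W`
controls integrals of Lipschitz functions (`IsJKOLimit.sq_integral_sub_le`). Weak convergence makes
the time averages of `η * v^ε` converge at each point, so equicontinuity upgrades this to a uniform
Cauchy property on compact sets (`exists_forall_abs_sub_le_of_cauchySeq_average`). Outside a large
ball, uniform first moments bound the remaining mass (`integral_abs_mul_abs_le`). -/

/-! ### Wasserstein distance and Lipschitz test functions -/

theorem wassersteinSq_self {d : ℕ} (μ : ProbabilityMeasure (Rd d)) : wassersteinSq μ μ = 0 := by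
  have hm : Measurable fun x : Rd d => (x, x) := measurable_id.prodMk measurable_id
  refine le_antisymm ?_ (zero_le)
  have hpl : (μ : Measure (Rd d)).map (fun x => (x, x)) ∈ transportPlans μ μ := by
    constructor
    · rw [Measure.map_map measurable_fst hm]
      exact Measure.map_id
    · rw [Measure.map_map measurable_snd hm]
      exact Measure.map_id
  refine (iInf₂_le _ hpl).trans ?_
  rw [lintegral_map (by fun_prop) hm]
  simp

/-- The product coupling has finite cost. Finiteness is essential because `toReal` sends `⊤` to `0`,
which would void upper bounds by `toReal`. -/
theorem wassersteinSq_ne_top {d : ℕ} {μ ν : ProbabilityMeasure (Rd d)} (hμ : μ ∈ P2 d)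
    (hν : ν ∈ P2 d) : wassersteinSq μ ν ≠ ⊤ := by
  refine ne_top_of_le_ne_top ?_
    (iInf₂_le ((μ : Measure (Rd d)).prod (ν : Measure (Rd d))) ⟨?_, ?_⟩)
  · have h1 : ∀ p : Rd d × Rd d, ‖p.1 - p.2‖ₑ ^ 2 ≤ 2 * (‖p.1‖ₑ ^ 2 + ‖p.2‖ₑ ^ 2) := by
      intro p
      have h := add_sq_le (a := ‖p.1‖) (b := ‖p.2‖)
      have h0 : ‖p.1 - p.2‖ ^ 2 ≤ 2 * (‖p.1‖ ^ 2 + ‖p.2‖ ^ 2) :=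
        (pow_le_pow_left₀ (norm_nonneg _) (norm_sub_le _ _) 2).trans h
      have h2 := ENNReal.ofReal_le_ofReal h0
      rw [ENNReal.ofReal_mul (by norm_num), ENNReal.ofReal_add (by positivity) (by positivity),
        ENNReal.ofReal_pow (norm_nonneg _), ENNReal.ofReal_pow (norm_nonneg _),
        ENNReal.ofReal_pow (norm_nonneg _)] at h2
      simpa only [ofReal_norm, ENNReal.ofReal_ofNat] using h2
    refine ne_top_of_le_ne_top ?_ (lintegral_mono h1)
    rw [lintegral_const_mul _ (by fun_prop), lintegral_add_left (by fun_prop)]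
    have h3 := lintegral_prod (μ := (μ : Measure (Rd d))) (ν := (ν : Measure (Rd d)))
      (fun p => ‖p.1‖ₑ ^ 2) (by fun_prop)
    have h4 := lintegral_prod (μ := (μ : Measure (Rd d))) (ν := (ν : Measure (Rd d)))
      (fun p => ‖p.2‖ₑ ^ 2) (by fun_prop)
    rw [h3, h4]
    simp only [lintegral_const, measure_univ, mul_one]
    exact ENNReal.mul_ne_top (by simp) (ENNReal.add_ne_top.2 ⟨hμ.ne, hν.ne⟩)
  · simp
  · simp

theorem integrable_of_continuous_of_bounded {X : Type*} [TopologicalSpace X] [MeasurableSpace X]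
    [BorelSpace X] {μ : Measure X} [IsFiniteMeasure μ] {φ : X → ℝ} (hφ : Continuous φ)
    (hb : ∃ B, ∀ x, |φ x| ≤ B) : Integrable φ μ := by
  obtain ⟨B, hB⟩ := hb
  exact .of_bound hφ.measurable.aestronglyMeasurable B (ae_of_all _ hB)

/-- Differences of integrals of a Lipschitz function are controlled by the Wasserstein distance. -/
theorem sq_integral_sub_le_wassersteinSq {d : ℕ} {μ ν : ProbabilityMeasure (Rd d)}
    (hμ : μ ∈ P2 d) (hν : ν ∈ P2 d) {φ : Rd d → ℝ} {L : NNReal} (hL0 : L ≠ 0)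
    (hL : LipschitzWith L φ)     (hb : ∃ B, ∀ x, |φ x| ≤ B) :
    (∫ x, φ x ∂(μ : Measure (Rd d)) - ∫ x, φ x ∂(ν : Measure (Rd d))) ^ 2
      ≤ L ^ 2 * (wassersteinSq μ ν).toReal := by
  set D := ∫ x, φ x ∂(μ : Measure (Rd d)) - ∫ x, φ x ∂(ν : Measure (Rd d))
  have key : ENNReal.ofReal (D ^ 2) ≤ (L : ℝ≥0∞) ^ 2 * wassersteinSq μ ν := by
    unfold wassersteinSq
    -- A nonzero finite factor may be moved inside the infimum over plans, so it suffices to bound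
    -- each plan separately.
    have hL' : (L : ℝ≥0∞) ^ 2 ≠ 0 := by simpa using hL0
    rw [ENNReal.mul_iInf_of_ne hL' (by simp)]
    refine le_iInf fun γ => ?_
    rw [ENNReal.mul_iInf_of_ne hL' (by simp)]
    refine le_iInf fun ⟨h1, h2⟩ => ?_
    have : IsProbabilityMeasure γ := by
      constructor
      have h := congrArg (fun m : Measure (Rd d) => m univ) h1
      simpa [Measure.map_apply measurable_fst MeasurableSet.univ] using h
    have hc1 : Continuous fun p : Rd d × Rd d => φ p.1 := hL.continuous.comp continuous_fst
    have hc2 : Continuous fun p : Rd d × Rd d => φ p.2 := hL.continuous.comp continuous_snd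
    have hD : D = ∫ p, (φ p.1 - φ p.2) ∂γ := by
      obtain ⟨B, hB⟩ := hb
      rw [integral_sub (integrable_of_continuous_of_bounded hc1 ⟨B, fun p => hB p.1⟩)
        (integrable_of_continuous_of_bounded hc2 ⟨B, fun p => hB p.2⟩)]
      simp only [D]
      rw [← h1, ← h2, integral_map measurable_fst.aemeasurable
        hL.continuous.measurable.aestronglyMeasurable,
        integral_map measurable_snd.aemeasurable hL.continuous.measurable.aestronglyMeasurable]
    have hmem : MemLp (fun p : Rd d × Rd d => φ p.1 - φ p.2) 2 γ := by
      obtain ⟨B, hB⟩ := hb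
      refine MemLp.of_bound (hc1.sub hc2).measurable.aestronglyMeasurable (B + B)
        (ae_of_all _ fun p => (norm_sub_le _ _).trans (add_le_add (hB _) (hB _)))
    -- Nonnegativity of the variance is Jensen's inequality for the square.
    have hvar := ProbabilityTheory.variance_nonneg (fun p : Rd d × Rd d => φ p.1 - φ p.2) γ
    rw [ProbabilityTheory.variance_eq_sub hmem] at hvar
    have h3 : D ^ 2 ≤ ∫ p, (φ p.1 - φ p.2) ^ 2 ∂γ := by
      rw [hD]
      exact sub_nonneg.1 hvar
    refine (ENNReal.ofReal_le_ofReal h3).trans ?_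
    rw [ofReal_integral_eq_lintegral_ofReal hmem.integrable_sq (ae_of_all _ fun p => sq_nonneg _),
      ← lintegral_const_mul _ (by fun_prop)]
    refine lintegral_mono fun p => ?_
    have h4 : (φ p.1 - φ p.2) ^ 2 ≤ (L * ‖p.1 - p.2‖) ^ 2 := by
      rw [← sq_abs]
      exact pow_le_pow_left₀ (abs_nonneg _) (by
        simpa [dist_eq_norm] using hL.dist_le_mul p.1 p.2) 2
    refine (ENNReal.ofReal_le_ofReal h4).trans ?_
    rw [ENNReal.ofReal_pow (by positivity), ENNReal.ofReal_mul (by positivity), mul_pow,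
      ofReal_norm, ENNReal.ofReal_coe_nnreal]
  have h := ENNReal.toReal_mono (ENNReal.mul_ne_top (by simp) (wassersteinSq_ne_top hμ hν)) key
  rwa [ENNReal.toReal_ofReal (sq_nonneg _), ENNReal.toReal_mul, ENNReal.toReal_pow] at h

/-! ### Rescaled kernels and the uniform bound on the initial energy -/

section kernel

variable {d : ℕ} {V : Rd d → ℝ}

theorem rescale_nonneg (hV : ∀ x, 0 ≤ V x) {ε : ℝ} (hε : 0 < ε) (x : Rd d) :
    0 ≤ rescale V ε x :=
  mul_nonneg (by positivity) (hV _)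

theorem rescale_continuous (hV : Continuous V) (ε : ℝ) : Continuous (rescale V ε) := by
  unfold rescale
  fun_prop

theorem integral_rescale_mul {ε : ℝ} (hε : 0 < ε) (h : Rd d → ℝ) :
    ∫ x, h x * rescale V ε x = ∫ x, h (ε • x) * V x := by
  have h1 := Measure.integral_comp_smul (volume : Measure (Rd d))
    (fun x => h x * V (ε⁻¹ • x)) ε
  simp only [inv_smul_smul₀ hε.ne', finrank_euclideanSpace, Fintype.card_fin, smul_eq_mul] at h1
  rw [h1, abs_of_pos (by positivity), ← integral_const_mul]
  exact integral_congr_ae (ae_of_all _ fun x => by simp only [rescale]; ring)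

theorem integral_rescale {ε : ℝ} (hε : 0 < ε) : ∫ x, rescale V ε x = ∫ x, V x := by
  simpa using integral_rescale_mul (V := V) hε fun _ => 1

theorem rescale_integrable (hV : Integrable V) {ε : ℝ} (hε : 0 < ε) :
    Integrable (rescale V ε) :=
  (hV.comp_smul (inv_ne_zero hε.ne')).const_mul _

theorem lintegral_enorm_rescale (hV : Integrable V) {ε : ℝ} (hε : 0 < ε) :
    ∫⁻ x, ‖rescale V ε x‖ₑ = ∫⁻ x, ‖V x‖ₑ := by
  rw [← ofReal_integral_norm_eq_lintegral_enorm hV,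
    ← ofReal_integral_norm_eq_lintegral_enorm (rescale_integrable hV hε),
    ← integral_rescale (V := fun x => ‖V x‖) hε]
  congr 2
  ext x
  simp only [rescale, norm_mul, norm_inv, norm_pow, Real.norm_eq_abs, abs_of_pos hε]

theorem interactionKernel_nonneg (hV : ∀ x, 0 ≤ V x) (x : Rd d) : 0 ≤ interactionKernel V x :=
  integral_nonneg fun _ => mul_nonneg (hV _) (hV _)

theorem AdmissibleKernel.continuous_interactionKernel (hV : AdmissibleKernel V) :
    Continuous (interactionKernel V) := by
  obtain ⟨B, hB⟩ := hV.bounded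
  refine BddAbove.continuous_convolution_right_of_integrable _ ⟨B, ?_⟩ hV.integrable hV.continuous
  rintro _ ⟨x, rfl⟩
  simpa [abs_of_nonneg (hV.nonneg x)] using hB x

theorem AdmissibleKernel.integrable_interactionKernel (hV : AdmissibleKernel V) :
    Integrable (interactionKernel V) :=
  hV.integrable.integrable_convolution _ hV.integrable

theorem interactionEnergy_nonneg (hV : ∀ x, 0 ≤ V x) {ε : ℝ} (hε : 0 < ε)
    (ρ : ProbabilityMeasure (Rd d)) : 0 ≤ interactionEnergy V ε ρ :=
  mul_nonneg (by norm_num) (integral_nonneg fun _ => integral_nonneg fun _ =>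
    rescale_nonneg (interactionKernel_nonneg hV) hε _)

/-- A double integral of a translation-invariant kernel against an `L²` density. -/
theorem lintegral_lintegral_kernel_le {K : Rd d → ℝ≥0∞} (hK : Measurable K)
    {f : Rd d → ℝ≥0∞} (hf : Measurable f) :
    ∫⁻ x, ∫⁻ y, K (x - y) * f y * f x ≤ 2 * ((∫⁻ x, K x) * ∫⁻ x, f x ^ 2) := by
  -- A crude Young inequality without the factor `1/2`; only finiteness of the constant matters.
  have h1 : ∀ x y, K (x - y) * f y * f x ≤ K (x - y) * f y ^ 2 + K (x - y) * f x ^ 2 := by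
    intro x y
    rw [mul_assoc, ← mul_add]
    gcongr
    rcases le_total (f x) (f y) with h | h
    · calc f y * f x ≤ f y * f y := by gcongr
        _ = f y ^ 2 := (sq _).symm
        _ ≤ _ := le_self_add
    · calc f y * f x ≤ f x * f x := by gcongr
        _ = f x ^ 2 := (sq _).symm
        _ ≤ _ := le_add_self
  refine (lintegral_mono fun x => lintegral_mono fun y => h1 x y).trans ?_
  have h2 : ∀ x, ∫⁻ y, (K (x - y) * f y ^ 2 + K (x - y) * f x ^ 2)
      = (∫⁻ y, K (x - y) * f y ^ 2) + (∫⁻ y, K y) * f x ^ 2 := by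
    intro x
    rw [lintegral_add_left (by fun_prop), lintegral_mul_const _ (by fun_prop),
      lintegral_sub_left_eq_self]
  simp only [h2]
  rw [lintegral_add_right _ (by fun_prop), lintegral_const_mul _ (by fun_prop),
    lintegral_lintegral_swap (by fun_prop)]
  have h3 : ∀ y, ∫⁻ x, K (x - y) * f y ^ 2 = (∫⁻ x, K x) * f y ^ 2 := by
    intro y
    rw [lintegral_mul_const _ (by fun_prop), lintegral_sub_right_eq_self]
  simp only [h3]
  rw [lintegral_const_mul _ (by fun_prop), two_mul]

/-- The initial energy is bounded uniformly in `ε`. -/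
theorem AdmissibleKernel.exists_interactionEnergy_le (hV : AdmissibleKernel V)
    {ρ₀ : ProbabilityMeasure (Rd d)} (hρ₀ : AdmissibleDatum ρ₀) :
    ∃ E : ℝ, ∀ ε ∈ Ioc (0 : ℝ) 1, interactionEnergy V ε ρ₀ ≤ E := by
  set W := interactionKernel V
  set f := (ρ₀ : Measure (Rd d)).rnDeriv volume
  have hf : Measurable f := Measure.measurable_rnDeriv _ _
  have hρf : (ρ₀ : Measure (Rd d)) = volume.withDensity f :=
    (Measure.withDensity_rnDeriv_eq _ _ hρ₀.absolutelyContinuous).symm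
  have hf2 : ∫⁻ x, f x ^ 2 ≠ ⊤ := by
    have h := hρ₀.density_memLp.integrable_sq.2
    have h' : ∀ᵐ x, f x ^ 2 = ‖(f x).toReal ^ 2‖ₑ := by
      filter_upwards [Measure.rnDeriv_lt_top (ρ₀ : Measure (Rd d)) volume] with x hx
      rw [enorm_pow, Real.enorm_of_nonneg ENNReal.toReal_nonneg, ENNReal.ofReal_toReal hx.ne]
    rw [lintegral_congr_ae h']
    exact h.ne
  have hM : ∫⁻ x, ‖W x‖ₑ ≠ ⊤ := hV.integrable_interactionKernel.2.ne
  refine ⟨(1 / 2) * (2 * ((∫⁻ x, ‖W x‖ₑ) * ∫⁻ x, f x ^ 2)).toReal, fun ε hε => ?_⟩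
  refine mul_le_mul_of_nonneg_left ?_ (by norm_num)
  have hWm := (rescale_continuous hV.continuous_interactionKernel ε).measurable
  rw [← ENNReal.ofReal_le_iff_le_toReal (by finiteness)]
  refine (Real.ofReal_le_enorm _).trans ?_
  refine (enorm_integral_le_lintegral_enorm _).trans ?_
  refine (lintegral_mono fun x => enorm_integral_le_lintegral_enorm _).trans ?_
  -- Rescaling preserves the `L¹` norm of the kernel; this makes the bound independent of `ε`.
  rw [← lintegral_enorm_rescale hV.integrable_interactionKernel hε.1]
  refine le_trans (le_of_eq ?_) (lintegral_lintegral_kernel_le hWm.enorm hf)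
  generalize rescale (interactionKernel V) ε = K at hWm ⊢
  rw [hρf, lintegral_withDensity_eq_lintegral_mul _ hf (by fun_prop)]
  refine lintegral_congr fun x => ?_
  rw [Pi.mul_apply, lintegral_withDensity_eq_lintegral_mul _ hf (by fun_prop), mul_comm,
    ← lintegral_mul_const _ (by fun_prop)]
  refine lintegral_congr fun y => ?_
  simp only [Pi.mul_apply]
  ring

end kernel

/-! ### Energy dissipation, Hölder continuity and moments along the scheme -/

section scheme

variable {d : ℕ} {V : Rd d → ℝ} {ε τ : ℝ} {ρ₀ : ProbabilityMeasure (Rd d)}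
  {r : ℕ → ProbabilityMeasure (Rd d)}

theorem IsJKOSequence.mem_P2 (hr : IsJKOSequence V ε τ ρ₀ r) (hρ₀ : ρ₀ ∈ P2 d) (n : ℕ) :
    r n ∈ P2 d := by
  cases n with
  | zero => rw [hr.1]; exact hρ₀
  | succ n => exact (hr.2 n).1

/-- The previous iterate is a competitor with zero transport cost, so the displacement is paid for
by the drop in energy. -/
theorem IsJKOSequence.wassersteinSq_le (hr : IsJKOSequence V ε τ ρ₀ r) (hρ₀ : ρ₀ ∈ P2 d)
    (hτ : 0 < τ) (n : ℕ) :
    (wassersteinSq (r n) (r (n + 1))).toReal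
      ≤ 2 * τ * (interactionEnergy V ε (r n) - interactionEnergy V ε (r (n + 1))) := by
  have h := (hr.2 n).2 (hr.mem_P2 hρ₀ n)
  simp only [mem_ofPred_eq, jkoFunctional, wassersteinSq_self, ENNReal.toReal_zero, zero_div,
    zero_add] at h
  have h' := (div_le_iff₀' (by positivity : 0 < 2 * τ)).1 (le_sub_iff_add_le.2 h)
  exact h'

theorem IsJKOSequence.energy_antitone (hr : IsJKOSequence V ε τ ρ₀ r) (hρ₀ : ρ₀ ∈ P2 d)
    (hτ : 0 < τ) : Antitone fun n => interactionEnergy V ε (r n) := by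
  refine antitone_nat_of_succ_le fun n => ?_
  have h := ENNReal.toReal_nonneg.trans (hr.wassersteinSq_le hρ₀ hτ n)
  exact sub_nonneg.1 (nonneg_of_mul_nonneg_right h (by positivity))

/-- Discrete `1/2`-Hölder estimate along the scheme, tested against Lipschitz functions. -/
theorem IsJKOSequence.sq_integral_sub_le (hr : IsJKOSequence V ε τ ρ₀ r) (hρ₀ : ρ₀ ∈ P2 d)
    (hτ : 0 < τ) (hV : ∀ x, 0 ≤ V x) (hε : 0 < ε) {φ : Rd d → ℝ} {L : NNReal} (hL0 : L ≠ 0)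
    (hL : LipschitzWith L φ) (hb : ∃ B, ∀ x, |φ x| ≤ B) {m n : ℕ} (hmn : m ≤ n) :
    (∫ x, φ x ∂(r n : Measure (Rd d)) - ∫ x, φ x ∂(r m : Measure (Rd d))) ^ 2
      ≤ 2 * L ^ 2 * interactionEnergy V ε ρ₀ * (τ * (n - m)) := by
  set a : ℕ → ℝ := fun n => ∫ x, φ x ∂(r n : Measure (Rd d))
  have h1 : ∀ i, (a (i + 1) - a i) ^ 2
      ≤ L ^ 2 * (2 * τ * (interactionEnergy V ε (r i) - interactionEnergy V ε (r (i + 1)))) := by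
    intro i
    have h := sq_integral_sub_le_wassersteinSq (hr.mem_P2 hρ₀ i) (hr.mem_P2 hρ₀ (i + 1)) hL0 hL hb
    rw [← neg_sub, neg_sq]
    exact h.trans (mul_le_mul_of_nonneg_left (hr.wassersteinSq_le hρ₀ hτ i) (by positivity))
  -- Cauchy–Schwarz over the `n - m` increments. Together with the factor `τ` from the dissipation,
  -- the count `n - m` becomes elapsed time, while the energy drops telescope.
  have h2 : (a n - a m) ^ 2 ≤ (n - m : ℕ) * ∑ i ∈ Finset.Ico m n, (a (i + 1) - a i) ^ 2 := by
    rw [← Finset.sum_Ico_sub a hmn]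
    simpa using sq_sum_le_card_mul_sum_sq (s := Finset.Ico m n) (f := fun i => a (i + 1) - a i)
  have h3 : ∑ i ∈ Finset.Ico m n, (a (i + 1) - a i) ^ 2
      ≤ L ^ 2 * (2 * τ * interactionEnergy V ε ρ₀) := by
    refine (Finset.sum_le_sum fun i _ => h1 i).trans ?_
    rw [← Finset.mul_sum, ← Finset.mul_sum]
    have h4 : ∑ i ∈ Finset.Ico m n,
        (interactionEnergy V ε (r i) - interactionEnergy V ε (r (i + 1)))
        = interactionEnergy V ε (r m) - interactionEnergy V ε (r n) := by
      rw [← neg_inj, ← Finset.sum_neg_distrib, neg_sub]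
      simp only [neg_sub]
      exact Finset.sum_Ico_sub (fun i => interactionEnergy V ε (r i)) hmn
    rw [h4]
    have h5 := hr.energy_antitone hρ₀ hτ (Nat.zero_le m)
    simp only [hr.1] at h5
    have h6 := interactionEnergy_nonneg hV hε (r n)
    gcongr
    linarith
  calc (a n - a m) ^ 2 ≤ (n - m : ℕ) * (L ^ 2 * (2 * τ * interactionEnergy V ε ρ₀)) :=
        h2.trans (by gcongr)
    _ = _ := by rw [Nat.cast_sub hmn]; ring

/-- `1/2`-Hölder estimate for limits of the scheme, tested against Lipschitz functions. -/
theorem IsJKOLimit.sq_integral_sub_le {T : ℝ} {ρ : ℝ → ProbabilityMeasure (Rd d)}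
    (hρ : IsJKOLimit V ε T ρ₀ ρ) (hρ₀ : ρ₀ ∈ P2 d) (hV : ∀ x, 0 ≤ V x) (hε : 0 < ε)
    {φ : Rd d → ℝ} {L : NNReal} (hL0 : L ≠ 0)
    (hL : LipschitzWith L φ) (hb : ∃ B, ∀ x, |φ x| ≤ B) {s t : ℝ} (hs : s ∈ Icc 0 T)
    (ht : t ∈ Icc 0 T) :
    (∫ x, φ x ∂(ρ t : Measure (Rd d)) - ∫ x, φ x ∂(ρ s : Measure (Rd d))) ^ 2
      ≤ 2 * L ^ 2 * interactionEnergy V ε ρ₀ * |t - s| := by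
  wlog hst : s ≤ t generalizing s t
  · rw [← neg_sub, neg_sq, abs_sub_comm]
    exact this ht hs (le_of_not_ge hst)
  obtain ⟨τ, r, hτ, hτ0, hr, hlim⟩ := hρ
  have hE := interactionEnergy_nonneg hV hε ρ₀
  have hconv : ∀ u ∈ Icc 0 T, Tendsto
      (fun j => ∫ x, φ x ∂(r j ⌈u / τ j⌉₊ : Measure (Rd d))) atTop
      (𝓝 (∫ x, φ x ∂(ρ u : Measure (Rd d)))) := by
    intro u hu
    obtain ⟨B, hB⟩ := hb
    exact ProbabilityMeasure.tendsto_iff_forall_integral_tendsto.1 (hlim u hu)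
      (BoundedContinuousFunction.ofNormedAddCommGroup φ hL.continuous B hB)
  rw [abs_of_nonneg (sub_nonneg.2 hst)]
  -- The extra `τ j` absorbs the rounding in the two ceilings and disappears in the limit.
  have hR : Tendsto (fun j => 2 * (L : ℝ) ^ 2 * interactionEnergy V ε ρ₀ * (t - s + τ j)) atTop
      (𝓝 (2 * L ^ 2 * interactionEnergy V ε ρ₀ * (t - s + 0))) :=
    (tendsto_const_nhds.add hτ0).const_mul _
  rw [add_zero] at hR
  refine le_of_tendsto_of_tendsto (((hconv t ht).sub (hconv s hs)).pow 2) hR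
    (Eventually.of_forall fun j => ?_)
  have hmn : ⌈s / τ j⌉₊ ≤ ⌈t / τ j⌉₊ :=
    Nat.ceil_mono (div_le_div_of_nonneg_right hst (hτ j).le)
  refine ((hr j).sq_integral_sub_le hρ₀ (hτ j) hV hε hL0 hL hb hmn).trans ?_
  refine mul_le_mul_of_nonneg_left ?_ (by positivity)
  have h1 : (⌈t / τ j⌉₊ : ℝ) < t / τ j + 1 := Nat.ceil_lt_add_one (div_nonneg ht.1 (hτ j).le)
  have h2 : s / τ j ≤ ⌈s / τ j⌉₊ := Nat.le_ceil _
  calc τ j * (⌈t / τ j⌉₊ - ⌈s / τ j⌉₊) ≤ τ j * (t / τ j + 1 - s / τ j) :=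
        mul_le_mul_of_nonneg_left (by linarith) (hτ j).le
    _ = t - s + τ j := by field_simp [(hτ j).ne']; ring

theorem IsJKOLimit.apply_zero {T : ℝ} (hT : 0 ≤ T) {ρ : ℝ → ProbabilityMeasure (Rd d)}
    (hρ : IsJKOLimit V ε T ρ₀ ρ) : ρ 0 = ρ₀ := by
  obtain ⟨τ, r, hτ, hτ0, hr, hlim⟩ := hρ
  refine tendsto_nhds_unique (hlim 0 ⟨le_rfl, hT⟩) ?_
  simp only [jkoInterpolation, zero_div, Nat.ceil_zero, (hr _).1]
  exact tendsto_const_nhds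

theorem integrable_norm_of_mem_P2 (hρ₀ : ρ₀ ∈ P2 d) :
    Integrable (fun x => ‖x‖) (ρ₀ : Measure (Rd d)) := by
  have h : MemLp (fun x : Rd d => x) 2 (ρ₀ : Measure (Rd d)) := by
    rw [memLp_two_iff_integrable_sq_norm (by fun_prop)]
    refine ⟨by fun_prop, ?_⟩
    rw [hasFiniteIntegral_iff_enorm]
    simpa using (show ∫⁻ x, ‖x‖ₑ ^ 2 ∂(ρ₀ : Measure (Rd d)) < ⊤ from hρ₀)
  exact (h.integrable (by norm_num)).norm

/-- Uniform bound on the truncated first moments of a limit of the scheme. -/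
theorem IsJKOLimit.integral_min_norm_le {T : ℝ} {ρ : ℝ → ProbabilityMeasure (Rd d)}
    (hρ : IsJKOLimit V ε T ρ₀ ρ) (hρ₀ : ρ₀ ∈ P2 d) (hV : ∀ x, 0 ≤ V x) (hε : 0 < ε)
    {t : ℝ} (ht : t ∈ Icc 0 T) {R : ℝ} (hR : 0 ≤ R) :
    ∫ x, min ‖x‖ R ∂(ρ t : Measure (Rd d)) ≤
      ∫ x, ‖x‖ ∂(ρ₀ : Measure (Rd d)) + √(2 * interactionEnergy V ε ρ₀ * T) := by
  have hT : 0 ≤ T := ht.1.trans ht.2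
  -- Truncation makes the norm a bounded test function, as narrow convergence requires, and keeps it
  -- 1-Lipschitz, so the resulting bound does not depend on `R`.
  have hL : LipschitzWith 1 fun x : Rd d => min ‖x‖ R := lipschitzWith_one_norm.min_const R
  have hb : ∃ B, ∀ x : Rd d, |min ‖x‖ R| ≤ B :=
    ⟨R, fun x => by rw [abs_of_nonneg (le_min (norm_nonneg _) hR)]; exact min_le_right _ _⟩
  have h := hρ.sq_integral_sub_le hρ₀ hV hε one_ne_zero hL hb ⟨le_rfl, hT⟩ ht
  rw [hρ.apply_zero hT, sub_zero, abs_of_nonneg ht.1] at h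
  have hE := interactionEnergy_nonneg hV hε ρ₀
  have h1 : ∫ x, min ‖x‖ R ∂(ρ₀ : Measure (Rd d)) ≤ ∫ x, ‖x‖ ∂(ρ₀ : Measure (Rd d)) :=
    integral_mono (integrable_of_continuous_of_bounded hL.continuous hb)
      (integrable_norm_of_mem_P2 hρ₀) fun x => min_le_left _ _
  have h2 : (∫ x, min ‖x‖ R ∂(ρ t : Measure (Rd d)) - ∫ x, min ‖x‖ R ∂(ρ₀ : Measure (Rd d))) ^ 2
      ≤ 2 * interactionEnergy V ε ρ₀ * T := by
    refine h.trans ?_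
    simp only [NNReal.coe_one, one_pow, mul_one]
    exact mul_le_mul_of_nonneg_left ht.2 (by positivity)
  have h3 := Real.le_sqrt_of_sq_le h2
  linarith

end scheme

/-! ### Smoothing a probability measure by a kernel -/

/-- Continuous, bounded probability densities. -/
structure IsKernelDensity {d : ℕ} (K : Rd d → ℝ) : Prop where
  nonneg : ∀ x, 0 ≤ K x
  continuous : Continuous K
  bounded : ∃ B : ℝ, ∀ x, |K x| ≤ B
  integrable : Integrable K
  integral_eq_one : ∫ x, K x = 1

theorem AdmissibleKernel.isKernelDensity_rescale {d : ℕ} {V : Rd d → ℝ} (hV : AdmissibleKernel V)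
    {ε : ℝ} (hε : 0 < ε) : IsKernelDensity (rescale V ε) where
  nonneg := rescale_nonneg hV.nonneg hε
  continuous := rescale_continuous hV.continuous ε
  bounded := by
    obtain ⟨B, hB⟩ := hV.bounded
    refine ⟨(ε ^ d)⁻¹ * B, fun x => ?_⟩
    rw [abs_of_nonneg (rescale_nonneg hV.nonneg hε x)]
    exact mul_le_mul_of_nonneg_left (hB _) (by positivity)
  integrable := rescale_integrable hV.integrable hε
  integral_eq_one := (integral_rescale hε).trans hV.integral_eq_one

theorem AdmissibleKernel.integrable_norm_mul_rescale {d : ℕ} {V : Rd d → ℝ}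
    (hV : AdmissibleKernel V) {ε : ℝ} (hε : 0 < ε) :
    Integrable fun x => ‖x‖ * rescale V ε x := by
  have h := (hV.integrable_moment.comp_smul (inv_ne_zero hε.ne')).const_mul ((ε ^ d)⁻¹ * ε)
  refine h.congr (ae_of_all _ fun x => ?_)
  simp only [rescale, norm_smul, norm_inv, Real.norm_eq_abs, abs_of_pos hε]
  field_simp

theorem AdmissibleKernel.integral_norm_mul_rescale_le {d : ℕ} {V : Rd d → ℝ}
    (hV : AdmissibleKernel V) {ε : ℝ} (hε : ε ∈ Ioc (0 : ℝ) 1) :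
    ∫ x, ‖x‖ * rescale V ε x ≤ ∫ x, ‖x‖ * V x := by
  rw [integral_rescale_mul hε.1 fun x => ‖x‖]
  refine integral_mono_of_nonneg (ae_of_all _ fun x => mul_nonneg (norm_nonneg _) (hV.nonneg x))
    hV.integrable_moment (ae_of_all _ fun x => mul_le_mul_of_nonneg_right ?_ (hV.nonneg x))
  rw [norm_smul, Real.norm_eq_abs, abs_of_pos hε.1]
  exact mul_le_of_le_one_left (norm_nonneg _) hε.2

section convMeasure

variable {d : ℕ} {K : Rd d → ℝ} (ρ : ProbabilityMeasure (Rd d))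

theorem IsKernelDensity.integrable_prod (hK : IsKernelDensity K) :
    Integrable (fun p : Rd d × Rd d => K (p.1 - p.2))
      ((volume : Measure (Rd d)).prod (ρ : Measure (Rd d))) := by
  have hc := hK.continuous
  rw [integrable_prod_iff' (by fun_prop)]
  refine ⟨ae_of_all _ fun y => hK.integrable.comp_sub_right y, ?_⟩
  simp only [integral_sub_right_eq_self (fun x => ‖K x‖)]
  exact integrable_const _

theorem IsKernelDensity.convMeasure_nonneg (hK : IsKernelDensity K) (x : Rd d) : 0 ≤ convMeasure K ρ x :=
  integral_nonneg fun _ => hK.nonneg _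

theorem IsKernelDensity.continuous_convMeasure (hK : IsKernelDensity K) :
    Continuous (convMeasure K ρ) := by
  have hc := hK.continuous
  obtain ⟨B, hB⟩ := hK.bounded
  exact continuous_of_dominated (bound := fun _ => B) (fun x => by fun_prop)
    (fun x => ae_of_all _ fun y => hB _) (integrable_const _)
    (ae_of_all _ fun y => by fun_prop)

theorem IsKernelDensity.bounded_convMeasure (hK : IsKernelDensity K) : ∃ B, ∀ x, |convMeasure K ρ x| ≤ B := by
  obtain ⟨B, hB⟩ := hK.bounded
  refine ⟨B, fun x => ?_⟩
  have h := norm_integral_le_of_norm_le_const (μ := (ρ : Measure (Rd d)))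
    (ae_of_all _ fun y => (Real.norm_eq_abs (K (x - y))).trans_le (hB (x - y)))
  simpa [convMeasure] using h

theorem IsKernelDensity.integrable_convMeasure (hK : IsKernelDensity K) : Integrable (convMeasure K ρ) :=
  (hK.integrable_prod ρ).integral_prod_left

/-- Fubini moves the kernel onto the test function, so that estimates for integrals against `ρ`
transfer to the density `K * ρ`. -/
theorem IsKernelDensity.integral_mul_convMeasure (hK : IsKernelDensity K)
    {h : Rd d → ℝ} (hh : Continuous h)
    (hb : ∃ B, ∀ x, |h x| ≤ B) :
    ∫ x, h x * convMeasure K ρ x = ∫ y, (∫ z, h (z + y) * K z) ∂(ρ : Measure (Rd d)) := by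
  obtain ⟨B, hB⟩ := hb
  have h1 : Integrable (fun p : Rd d × Rd d => h p.1 * K (p.1 - p.2))
      ((volume : Measure (Rd d)).prod (ρ : Measure (Rd d))) :=
    (hK.integrable_prod ρ).bdd_mul (c := B)
      (hh.comp continuous_fst).measurable.aestronglyMeasurable (ae_of_all _ fun p => hB _)
  simp only [convMeasure, ← integral_const_mul]
  rw [integral_integral_swap h1]
  refine integral_congr_ae (ae_of_all _ fun y => ?_)
  simpa using (integral_add_right_eq_self (fun x => h x * K (x - y)) y).symm

theorem IsKernelDensity.integral_convMeasure (hK : IsKernelDensity K) : ∫ x, convMeasure K ρ x = 1 := by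
  have h := hK.integral_mul_convMeasure ρ (h := fun _ => 1) continuous_const ⟨1, by simp⟩
  simpa [hK.integral_eq_one] using h

/-- By the triangle inequality, `min ‖z + y‖ R ≤ min ‖y‖ R + ‖z‖`; integrating against `K(z) dz
dρ(y)` separates the two moments. -/
theorem IsKernelDensity.integral_min_mul_convMeasure_le (hK : IsKernelDensity K)
    (hm : Integrable fun x => ‖x‖ * K x) {R : ℝ} (hR : 0 ≤ R) :
    ∫ x, min ‖x‖ R * convMeasure K ρ x ≤
      ∫ x, min ‖x‖ R ∂(ρ : Measure (Rd d)) + ∫ x, ‖x‖ * K x := by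
  have hc : Continuous fun x : Rd d => min ‖x‖ R := by fun_prop
  have hb : ∀ x : Rd d, |min ‖x‖ R| ≤ R :=
    fun x => by rw [abs_of_nonneg (le_min (norm_nonneg _) hR)]; exact min_le_right _ _
  rw [hK.integral_mul_convMeasure ρ hc ⟨R, hb⟩]
  have hi := integrable_of_continuous_of_bounded (μ := (ρ : Measure (Rd d))) hc ⟨R, hb⟩
  have h1 : ∀ y : Rd d, ∫ z, min ‖z + y‖ R * K z ≤ min ‖y‖ R + ∫ x, ‖x‖ * K x := by
    intro y
    have h2 : min ‖y‖ R + ∫ x, ‖x‖ * K x = ∫ x, (min ‖y‖ R * K x + ‖x‖ * K x) := by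
      rw [integral_add (hK.integrable.const_mul _) hm, integral_const_mul, hK.integral_eq_one,
        mul_one]
    rw [h2]
    refine integral_mono_of_nonneg
      (ae_of_all _ fun z => mul_nonneg (le_min (norm_nonneg _) hR) (hK.nonneg z))
      ((hK.integrable.const_mul _).add hm) (ae_of_all _ fun z => ?_)
    simp only
    rw [← add_mul]
    refine mul_le_mul_of_nonneg_right ?_ (hK.nonneg z)
    have h3 := norm_add_le z y
    rcases le_total ‖y‖ R with h | h
    · rw [min_eq_left h, add_comm ‖y‖]
      exact (min_le_left _ _).trans h3
    · rw [min_eq_right h]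
      exact (min_le_right _ _).trans (le_add_of_nonneg_right (norm_nonneg _))
  calc _ ≤ ∫ y, (min ‖y‖ R + ∫ x, ‖x‖ * K x) ∂(ρ : Measure (Rd d)) :=
        integral_mono_of_nonneg (ae_of_all _ fun y => integral_nonneg fun z =>
          mul_nonneg (le_min (norm_nonneg _) hR) (hK.nonneg z)) (hi.add (integrable_const _))
          (ae_of_all _ h1)
    _ = _ := by rw [integral_add hi (integrable_const _)]; simp

/-- Averages `∫ h(z + y) K(z) dz` of a Lipschitz function are Lipschitz. -/
theorem IsKernelDensity.lipschitzWith_average (hK : IsKernelDensity K)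
    {h : Rd d → ℝ} {L : NNReal}
    (hL : LipschitzWith L h) (hb : ∃ B, ∀ x, |h x| ≤ B) :
    LipschitzWith L fun y => ∫ z, h (z + y) * K z := by
  obtain ⟨B, hB⟩ := hb
  have hc := hL.continuous
  have hi : ∀ y, Integrable fun z => h (z + y) * K z := fun y =>
    hK.integrable.bdd_mul (c := B) (by fun_prop) (ae_of_all _ fun p => hB _)
  refine LipschitzWith.of_dist_le_mul fun x y => ?_
  rw [Real.dist_eq, ← integral_sub (hi x) (hi y)]
  have h1 : L * dist x y = ∫ z, L * dist x y * K z := by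
    rw [integral_const_mul, hK.integral_eq_one, mul_one]
  rw [h1, ← Real.norm_eq_abs]
  refine norm_integral_le_of_norm_le (hK.integrable.const_mul _) (ae_of_all _ fun z => ?_)
  rw [← sub_mul, norm_mul, Real.norm_of_nonneg (hK.nonneg z)]
  refine mul_le_mul_of_nonneg_right ?_ (hK.nonneg z)
  simpa [Real.dist_eq] using hL.dist_le_mul (z + x) (z + y)

theorem IsKernelDensity.bounded_average (hK : IsKernelDensity K)
    {h : Rd d → ℝ} {B : ℝ} (hB : ∀ x, |h x| ≤ B) (y : Rd d) :
    |∫ z, h (z + y) * K z| ≤ B := by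
  have h1 : B = ∫ z, B * K z := by
    rw [integral_const_mul, hK.integral_eq_one, mul_one]
  rw [h1, ← Real.norm_eq_abs]
  refine norm_integral_le_of_norm_le (hK.integrable.const_mul _) (ae_of_all _ fun z => ?_)
  rw [norm_mul, Real.norm_of_nonneg (hK.nonneg z)]
  exact mul_le_mul_of_nonneg_right (hB _) (hK.nonneg z)

theorem IsKernelDensity.integrable_mul_convMeasure (hK : IsKernelDensity K)
    {h : Rd d → ℝ} (hh : Continuous h)
    (hb : ∃ B, ∀ x, |h x| ≤ B) : Integrable fun x => h x * convMeasure K ρ x := by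
  obtain ⟨B, hB⟩ := hb
  exact (hK.integrable_convMeasure ρ).bdd_mul (c := B) hh.measurable.aestronglyMeasurable
    (ae_of_all _ hB)

end convMeasure

/-! ### Equicontinuity of mollified densities -/

/-- The value at `x` of `η * f`. -/
noncomputable def mollify {d : ℕ} (η f : Rd d → ℝ) (x : Rd d) : ℝ := ∫ y, η (x - y) * f y

section mollify

variable {d : ℕ} {K : Rd d → ℝ} {η : Rd d → ℝ} {L : NNReal} {B : ℝ}

/-- The density `K * ρ` has unit mass, so the Lipschitz constant of `η` is inherited whatever the
kernel and the measure; hence uniformity in `ε` and `t`. -/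
theorem abs_mollify_convMeasure_sub_le (hK : IsKernelDensity K)
    (hL : LipschitzWith L η) (hB : ∀ x, |η x| ≤ B) (ρ : ProbabilityMeasure (Rd d)) (x x' : Rd d) :
    |mollify η (convMeasure K ρ) x - mollify η (convMeasure K ρ) x'| ≤ L * dist x x' := by
  have hc := hL.continuous
  have hi : ∀ x, Integrable fun y => η (x - y) * convMeasure K ρ y := fun x =>
    hK.integrable_mul_convMeasure ρ (by fun_prop) ⟨B, fun y => hB _⟩
  unfold mollify
  rw [← integral_sub (hi x) (hi x')]
  have h1 : L * dist x x' = ∫ y, L * dist x x' * convMeasure K ρ y := by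
    rw [integral_const_mul, hK.integral_convMeasure, mul_one]
  rw [h1, ← Real.norm_eq_abs]
  refine norm_integral_le_of_norm_le ((hK.integrable_convMeasure ρ).const_mul _)
    (ae_of_all _ fun y => ?_)
  rw [← sub_mul, norm_mul, Real.norm_of_nonneg (hK.convMeasure_nonneg ρ y)]
  refine mul_le_mul_of_nonneg_right ?_ (hK.convMeasure_nonneg ρ y)
  simpa [Real.dist_eq] using hL.dist_le_mul (x - y) (x' - y)

theorem abs_mollify_convMeasure_le (hK : IsKernelDensity K)
    (hB : ∀ x, |η x| ≤ B) (ρ : ProbabilityMeasure (Rd d)) (x : Rd d) :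
    |mollify η (convMeasure K ρ) x| ≤ B := by
  have h1 : B = ∫ y, B * convMeasure K ρ y := by
    rw [integral_const_mul, hK.integral_convMeasure, mul_one]
  unfold mollify
  rw [h1, ← Real.norm_eq_abs]
  refine norm_integral_le_of_norm_le ((hK.integrable_convMeasure ρ).const_mul _)
    (ae_of_all _ fun y => ?_)
  rw [norm_mul, Real.norm_of_nonneg (hK.convMeasure_nonneg ρ y)]
  exact mul_le_mul_of_nonneg_right (hB _) (hK.convMeasure_nonneg ρ y)

/-- `1/2`-Hölder continuity in time of the mollified densities. -/
theorem sq_mollify_convMeasure_sub_le (hK : IsKernelDensity K)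
    (hL : LipschitzWith L η) (hB : ∀ x, |η x| ≤ B) (hL0 : L ≠ 0) {V : Rd d → ℝ} {ε T : ℝ}
    {ρ₀ : ProbabilityMeasure (Rd d)} {ρ : ℝ → ProbabilityMeasure (Rd d)}
    (hρ : IsJKOLimit V ε T ρ₀ ρ) (hρ₀ : ρ₀ ∈ P2 d) (hV : ∀ x, 0 ≤ V x) (hε : 0 < ε)
    {s t : ℝ} (hs : s ∈ Icc 0 T) (ht : t ∈ Icc 0 T) (x : Rd d) :
    (mollify η (convMeasure K (ρ t)) x - mollify η (convMeasure K (ρ s)) x) ^ 2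
      ≤ 2 * L ^ 2 * interactionEnergy V ε ρ₀ * |t - s| := by
  have hLx : LipschitzWith L fun y => η (x - y) := by
    refine LipschitzWith.of_dist_le_mul fun y y' => ?_
    simpa only [dist_sub_left] using hL.dist_le_mul (x - y) (x - y')
  -- The mollified value is an integral against `ρ` of an average of translates of `η`, which has
  -- the same Lipschitz constant `L`.
  have h1 : ∀ ρ, mollify η (convMeasure K ρ) x
      = ∫ y, (∫ z, η (x - (z + y)) * K z) ∂(ρ : Measure (Rd d)) := fun ρ =>
    hK.integral_mul_convMeasure ρ hLx.continuous ⟨B, fun y => hB _⟩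
  rw [h1, h1]
  exact hρ.sq_integral_sub_le hρ₀ hV hε hL0 (hK.lipschitzWith_average hLx ⟨B, fun y => hB _⟩)
    ⟨B, hK.bounded_average (h := fun y => η (x - y)) fun y => hB _⟩ hs ht

end mollify

/-! ### Translation estimate in `H¹` and splitting of the `L²` norm -/

/-- Translation by `z` on `L²(ℝ^d)`. -/
noncomputable def translateL2 {d : ℕ} (z : Rd d) : L2Rd d →ₗᵢ[ℝ] L2Rd d :=
  Lp.compMeasurePreservingₗᵢ ℝ (fun x => x - z) (measurePreserving_sub_right volume z)

theorem coeFn_translateL2 {d : ℕ} (z : Rd d) (u : L2Rd d) :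
    translateL2 z u =ᵐ[volume] fun x => u (x - z) :=
  Lp.coeFn_compMeasurePreserving u (measurePreserving_sub_right volume z)

theorem abs_integral_inner_mul_le {d : ℕ} (g : L2RdVec d) (φ : L2Rd d) (e : Rd d) :
    |∫ x, inner ℝ (g x) e * φ x| ≤ ‖e‖ * ‖g‖ * ‖φ‖ := by
  set ψ : L2RdVec d := (ContinuousLinearMap.toSpanSingleton ℝ e).compLp φ
  have h1 : ∫ x, inner ℝ (g x) e * φ x = inner ℝ g ψ := by
    rw [L2.inner_def]
    refine integral_congr_ae ?_
    filter_upwards [(ContinuousLinearMap.toSpanSingleton ℝ e).coeFn_compLp φ] with x hx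
    rw [hx]
    simp [inner_smul_right, mul_comm]
  have h2 : ‖ψ‖ ≤ ‖e‖ * ‖φ‖ := by
    simpa using (ContinuousLinearMap.toSpanSingleton ℝ e).norm_compLp_le φ
  rw [h1]
  calc _ ≤ ‖g‖ * ‖ψ‖ := abs_real_inner_le_norm _ _
    _ ≤ ‖g‖ * (‖e‖ * ‖φ‖) := by gcongr
    _ = _ := by ring

/-- The function `F(y) = ∫ u(x) φ(x - y) dx` has derivative `∫ (g · e) φ(x - y) dx` in direction
`e`, since `g` is the weak gradient. Cauchy–Schwarz bounds this derivative, and the mean value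
inequality between `0` and `z` concludes. -/
theorem HasWeakGradient.abs_inner_translate_sub_le_of_contDiff {d : ℕ} {u : L2Rd d}
    {g : L2RdVec d} (hug : HasWeakGradient u g) {φ : Rd d → ℝ} (hφ : ContDiff ℝ ∞ φ)
    (hc : HasCompactSupport φ) (φL : L2Rd d) (hφL : φL =ᵐ[volume] φ) (z : Rd d) :
    |inner ℝ u (translateL2 z φL - φL)| ≤ ‖z‖ * ‖g‖ * ‖φL‖ := by
  -- Reflecting `φ` turns the pairing with translates into the convolution `u * ψ`, which can be
  -- differentiated on the smooth factor.
  set ψ : Rd d → ℝ := fun x => φ (-x)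
  have hψ : ContDiff ℝ 1 ψ := (hφ.of_le (by simp)).comp contDiff_neg
  have hψc : HasCompactSupport ψ := hc.comp_homeomorph (Homeomorph.neg _)
  have hu : LocallyIntegrable u volume := (Lp.memLp u).locallyIntegrable (by norm_num)
  set F : Rd d → ℝ := convolution u ψ (ContinuousLinearMap.mul ℝ ℝ) volume
  have hF : ∀ y, F y = ∫ x, u x * φ (x - y) := by
    intro y
    simp [F, convolution, ψ]
  have htr : ∀ y, (translateL2 y φL : Rd d → ℝ) =ᵐ[volume] fun x => φ (x - y) := by
    intro y
    have := (measurePreserving_sub_right (volume : Measure (Rd d)) y).quasiMeasurePreserving.ae_eq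
      hφL
    exact (coeFn_translateL2 y φL).trans this
  have hFd : ∀ y e, |fderiv ℝ F y e| ≤ ‖e‖ * ‖g‖ * ‖φL‖ := by
    intro y e
    have h1 := (hψc.hasFDerivAt_convolution_right (ContinuousLinearMap.mul ℝ ℝ) hu hψ y).fderiv
    have h2 : fderiv ℝ F y e = ∫ x, u x * fderiv ℝ ψ (y - x) e := by
      rw [h1, convolution_precompR_apply _ hu (hψc.fderiv ℝ) (hψ.continuous_fderiv one_ne_zero)]
      rfl
    have h3 : ∀ x, fderiv ℝ ψ (y - x) e = - fderiv ℝ (fun x => φ (x - y)) x e := by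
      intro x
      have hd : DifferentiableAt ℝ φ (x - y) := (hφ.differentiable (by simp)) _
      have h4 : HasFDerivAt ψ ((fderiv ℝ φ (x - y)).comp (-ContinuousLinearMap.id ℝ (Rd d)))
          (y - x) := by
        have hd' : HasFDerivAt φ (fderiv ℝ φ (x - y)) (-(y - x)) := by
          rw [neg_sub]; exact hd.hasFDerivAt
        exact hd'.comp (y - x) (hasFDerivAt_id (y - x)).neg
      rw [h4.fderiv, fderiv_comp_sub]
      simp
    simp only [h3, mul_neg, integral_neg] at h2
    rw [hug (fun x => φ (x - y)) (hφ.comp (contDiff_id.sub contDiff_const))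
      (hc.comp_homeomorph (Homeomorph.subRight y)), neg_neg] at h2
    have h5 : ∫ x, inner ℝ (g x) e * φ (x - y) = ∫ x, inner ℝ (g x) e * translateL2 y φL x := by
      refine integral_congr_ae ?_
      filter_upwards [htr y] with x hx
      rw [hx]
    rw [h2, h5]
    simpa using abs_integral_inner_mul_le g (translateL2 y φL) e
  have hFD : ∀ y, DifferentiableAt ℝ F y := fun y =>
    (hψc.hasFDerivAt_convolution_right (ContinuousLinearMap.mul ℝ ℝ) hu hψ y).differentiableAt
  have h6 : |F z - F 0| ≤ ‖z‖ * ‖g‖ * ‖φL‖ := by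
    have h7 := Convex.norm_image_sub_le_of_norm_fderiv_le (𝕜 := ℝ) (f := F) (s := univ)
      (C := ‖g‖ * ‖φL‖) (x := 0) (y := z) (fun y _ => hFD y)
      (fun y _ => ContinuousLinearMap.opNorm_le_bound _ (by positivity) fun e => by
        refine (hFd y e).trans (le_of_eq (by ring))) convex_univ trivial trivial
    rw [sub_zero] at h7
    exact h7.trans (le_of_eq (by ring))
  have h8 : ∀ y, inner ℝ u (translateL2 y φL) = F y := by
    intro y
    rw [hF, L2.inner_def]
    refine integral_congr_ae ?_
    filter_upwards [htr y] with x hx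
    rw [hx]
    simp [mul_comm]
  have h9 : inner ℝ u φL = F 0 := by
    rw [hF, L2.inner_def]
    refine integral_congr_ae ?_
    filter_upwards [hφL] with x hx
    rw [hx]
    simp [mul_comm]
  rwa [inner_sub_right, h8, h9]

/-- For `u ∈ H¹`, the increment `u(· + z) - u` has `L²`-norm at most `|z| ‖∇u‖` (in dual form). -/
theorem HasWeakGradient.abs_inner_translate_sub_le {d : ℕ} {u : L2Rd d}
    {g : L2RdVec d} (hug : HasWeakGradient u g) (φ : L2Rd d) (z : Rd d) :
    |inner ℝ u (translateL2 z φ - φ)| ≤ ‖z‖ * ‖g‖ * ‖φ‖ := by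
  have hd := Lp.dense_hasCompactSupport_contDiff (E := Rd d) (F := ℝ) (μ := volume) (p := 2)
    (by simp)
  have hcl : IsClosed {φ : L2Rd d | |inner ℝ u (translateL2 z φ - φ)| ≤ ‖z‖ * ‖g‖ * ‖φ‖} := by
    have := (translateL2 z).continuous
    exact isClosed_le (by fun_prop) (by fun_prop)
  have hsub : closure {f : L2Rd d | ∃ g : Rd d → ℝ, f =ᵐ[volume] g ∧ HasCompactSupport g ∧
      ContDiff ℝ ∞ g} ⊆ {φ : L2Rd d | |inner ℝ u (translateL2 z φ - φ)| ≤ ‖z‖ * ‖g‖ * ‖φ‖} := by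
    refine closure_minimal ?_ hcl
    rintro f ⟨ψ, h1, h2, h3⟩
    exact hug.abs_inner_translate_sub_le_of_contDiff h3 h2 f h1 z
  exact hsub (hd φ)

/-- Splitting of the `L²`-norm of an `H¹` function into a part controlled by the gradient and
a part controlled by a mollification. -/
theorem HasWeakGradient.norm_sq_le_mollify {d : ℕ} {u : L2Rd d} {g : L2RdVec d}
    (hug : HasWeakGradient u g) {f : Rd d → ℝ} (huf : u =ᵐ[volume] f) (hfc : Continuous f)
    (hfb : ∃ B, ∀ x, |f x| ≤ B) (hfi : Integrable f) {η : Rd d → ℝ} (hη0 : ∀ x, 0 ≤ η x)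
    (hηi : Integrable η) (hη1 : ∫ x, η x = 1) {δ : ℝ}
    (hηδ : ∀ x, η x ≠ 0 → ‖x‖ ≤ δ) :
    ‖u‖ ^ 2 ≤ δ * (‖g‖ * ‖u‖) + ∫ x, |f x| * |mollify η f x| := by
  obtain ⟨B, hB⟩ := hfb
  have hnorm : ‖u‖ ^ 2 = ∫ x, f x * f x := by
    rw [← real_inner_self_eq_norm_sq, L2.inner_def]
    refine integral_congr_ae ?_
    filter_upwards [huf] with x hx
    rw [hx]
    simp [sq]
  have hinner : ∀ z, inner ℝ u (translateL2 z u) = ∫ x, f x * f (x - z) := by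
    intro z
    have h1 := (measurePreserving_sub_right (volume : Measure (Rd d)) z).quasiMeasurePreserving.ae_eq
      huf
    rw [L2.inner_def]
    refine integral_congr_ae ?_
    filter_upwards [huf, (coeFn_translateL2 z u).trans h1] with x hx hx'
    rw [hx, hx']
    simp [mul_comm]
  -- The translation estimate tested with `u` itself, weighted by `η`. Integration in `z` and Fubini
  -- turn the correlation into `∫ f (η * f)`.
  have hz : ∀ z, η z * ‖u‖ ^ 2 - η z * ∫ x, f x * f (x - z) ≤ η z * (δ * (‖g‖ * ‖u‖)) := by
    intro z
    rw [← mul_sub]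
    by_cases h0 : η z = 0
    · simp [h0]
    refine mul_le_mul_of_nonneg_left ?_ (hη0 z)
    have h1 := hug.abs_inner_translate_sub_le u z
    rw [inner_sub_right, hinner, real_inner_self_eq_norm_sq] at h1
    have h2 := (abs_le.1 h1).1
    have h3 : ‖z‖ * ‖g‖ * ‖u‖ ≤ δ * (‖g‖ * ‖u‖) := by
      rw [mul_assoc]
      exact mul_le_mul_of_nonneg_right (hηδ z h0) (by positivity)
    linarith
  have hP : Integrable (fun p : Rd d × Rd d => f p.1 * (η (p.1 - p.2) * f p.2))
      (volume.prod volume) := by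
    have h1 : Integrable (fun p : Rd d × Rd d => η (p.1 - p.2) * f p.2)
        (volume.prod volume) := by
      refine (hfi.convolution_integrand (ContinuousLinearMap.mul ℝ ℝ) hηi).congr
        (ae_of_all _ fun p => ?_)
      simp [mul_comm]
    exact h1.bdd_mul (c := B) (by fun_prop) (ae_of_all _ fun p => hB _)
  have hQ : Integrable (fun p : Rd d × Rd d => f p.1 * (η p.2 * f (p.1 - p.2)))
      (volume.prod volume) := by
    have h1 : Integrable (fun p : Rd d × Rd d => η p.2 * f (p.1 - p.2))
        (volume.prod volume) :=
      hηi.convolution_integrand (ContinuousLinearMap.mul ℝ ℝ) hfi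
    exact h1.bdd_mul (c := B) (by fun_prop) (ae_of_all _ fun p => hB _)
  have hswap : ∫ z, η z * ∫ x, f x * f (x - z) = ∫ x, f x * mollify η f x := by
    have h1 := integral_integral_swap (f := fun x z => f x * (η z * f (x - z))) hQ
    have h2 : ∀ x, ∫ z, f x * (η z * f (x - z)) = f x * mollify η f x := by
      intro x
      rw [integral_const_mul, mollify, ← integral_sub_left_eq_self _ volume x]
      simp
    simp only [h2] at h1
    rw [h1]
    refine integral_congr_ae (ae_of_all _ fun z => ?_)
    simp only [← integral_const_mul]
    refine integral_congr_ae (ae_of_all _ fun x => ?_)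
    simp only
    ring
  have hI : Integrable fun z => η z * ∫ x, f x * f (x - z) := by
    refine hQ.integral_prod_right.congr (ae_of_all _ fun z => ?_)
    simp only [← integral_const_mul]
    refine integral_congr_ae (ae_of_all _ fun x => ?_)
    simp only
    ring
  have hmono := integral_mono ((hηi.mul_const (‖u‖ ^ 2)).sub hI)
    (hηi.mul_const (δ * (‖g‖ * ‖u‖))) hz
  simp only [Pi.sub_apply] at hmono
  rw [integral_sub (hηi.mul_const _) hI, integral_mul_const, integral_mul_const, hη1, one_mul,
    one_mul, hswap] at hmono
  have hJ : Integrable fun x => f x * mollify η f x := by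
    refine hP.integral_prod_left.congr (ae_of_all _ fun x => ?_)
    simp only [integral_const_mul, mollify]
  have habs : ∫ x, f x * mollify η f x ≤ ∫ x, |f x| * |mollify η f x| := by
    refine integral_mono hJ (hJ.abs.congr (ae_of_all _ fun x => abs_mul _ _)) fun x => ?_
    simp only
    rw [← abs_mul]
    exact le_abs_self _
  linarith

/-! ### Tightness and local uniform convergence -/

/-- Tightness estimate for the mollified part. -/
theorem integral_abs_mul_abs_le {d : ℕ} {f₁ f₂ w : Rd d → ℝ} (h₁ : ∀ x, 0 ≤ f₁ x)
    (h₂ : ∀ x, 0 ≤ f₂ x) (hc₁ : Integrable f₁) (hc₂ : Integrable f₂)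
    (hi₁ : ∫ x, f₁ x = 1) (hi₂ : ∫ x, f₂ x = 1) {R : ℝ} (hR : 0 < R) {M : ℝ}
    (hm₁ : ∫ x, min ‖x‖ R * f₁ x ≤ M) (hm₂ : ∫ x, min ‖x‖ R * f₂ x ≤ M)
    {κ : ℝ} (hκ : 0 ≤ κ) (hw : ∀ x, ‖x‖ ≤ R → |w x| ≤ κ) {B : ℝ} (hB : 0 ≤ B)
    (hwB : ∀ x, |w x| ≤ B) :
    ∫ x, |f₁ x - f₂ x| * |w x| ≤ 2 * κ + 2 * B * M / R := by
  have hmi : ∀ f : Rd d → ℝ, Integrable f → Integrable fun x => min ‖x‖ R * f x := fun f hf =>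
    hf.bdd_mul (c := R) (by fun_prop) (ae_of_all _ fun x => by
      rw [Real.norm_of_nonneg (le_min (norm_nonneg _) hR.le)]; exact min_le_right _ _)
  have hpt : ∀ x, |f₁ x - f₂ x| * |w x|
      ≤ κ * (f₁ x + f₂ x) + B / R * (min ‖x‖ R * f₁ x + min ‖x‖ R * f₂ x) := by
    intro x
    have hf : |f₁ x - f₂ x| ≤ f₁ x + f₂ x := by
      rw [abs_le]
      constructor <;> linarith [h₁ x, h₂ x]
    -- Chebyshev's argument: outside the ball `min ‖x‖ R / R` equals one, so the second term alone
    -- dominates `B`.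
    have hwx : |w x| ≤ κ + B / R * min ‖x‖ R := by
      rcases le_total ‖x‖ R with h | h
      · exact (hw x h).trans (le_add_of_nonneg_right (by positivity))
      · rw [min_eq_right h, div_mul_cancel₀ _ hR.ne']
        exact (hwB x).trans (le_add_of_nonneg_left hκ)
    calc _ ≤ (f₁ x + f₂ x) * (κ + B / R * min ‖x‖ R) :=
          mul_le_mul hf hwx (abs_nonneg _) (add_nonneg (h₁ x) (h₂ x))
      _ = _ := by ring
  have hi₃ : Integrable fun x => κ * (f₁ x + f₂ x) := (hc₁.add hc₂).const_mul _
  have hi₄ : Integrable fun x => B / R * (min ‖x‖ R * f₁ x + min ‖x‖ R * f₂ x) :=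
    ((hmi f₁ hc₁).add (hmi f₂ hc₂)).const_mul _
  refine (integral_mono_of_nonneg (ae_of_all _ fun x => by positivity) (hi₃.add hi₄)
    (ae_of_all _ hpt)).trans ?_
  rw [integral_add' hi₃ hi₄, integral_const_mul, integral_const_mul, integral_add hc₁ hc₂,
    integral_add (hmi f₁ hc₁) (hmi f₂ hc₂), hi₁, hi₂]
  have h3 : B / R * ((∫ x, min ‖x‖ R * f₁ x) + ∫ x, min ‖x‖ R * f₂ x) ≤ B / R * (M + M) := by
    gcongr
  calc _ ≤ κ * (1 + 1) + B / R * (M + M) := by gcongr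
    _ = _ := by ring

/-- Equicontinuity in time and space together with convergence of the time averages implies
uniform convergence on compact sets (in Cauchy form). -/
theorem exists_forall_abs_sub_le_of_cauchySeq_average {X : Type*} [MetricSpace X] {T : ℝ}
    (hT : 0 < T) {F : ℕ → ℝ → X → ℝ} {L : NNReal} {A : ℝ} (hA : 0 ≤ A)
    (hx : ∀ k, ∀ t, ∀ x x', |F k t x - F k t x'| ≤ L * dist x x')
    (ht : ∀ k, ∀ s ∈ Icc 0 T, ∀ t ∈ Icc 0 T, ∀ x, (F k t x - F k s x) ^ 2 ≤ A * |t - s|)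
    (hint : ∀ k x, IntegrableOn (fun t => F k t x) (Icc 0 T))
    (hcau : ∀ a b x, CauchySeq fun k => ∫ t in Icc a b ∩ Icc 0 T, F k t x)
    {S : Set X} (hS : IsCompact S) {κ : ℝ} (hκ : 0 < κ) :
    ∃ N, ∀ k ≥ N, ∀ l ≥ N, ∀ t ∈ Icc 0 T, ∀ x ∈ S, |F k t x - F l t x| ≤ κ := by
  suffices h : ∃ N, ∀ k ≥ N, ∀ l ≥ N, ∀ p ∈ Icc 0 T ×ˢ S, |F k p.1 p.2 - F l p.1 p.2| ≤ κ by
    obtain ⟨N, hN⟩ := h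
    exact ⟨N, fun k hk l hl t htT x hxS => hN k hk l hl (t, x) ⟨htT, hxS⟩⟩
  -- By compactness of `[0,T] × S` it suffices to find a suitable neighbourhood of each point, with
  -- its own threshold `N`.
  refine IsCompact.induction_on (p := fun Q : Set (ℝ × X) => ∃ N, ∀ k ≥ N, ∀ l ≥ N, ∀ p ∈ Q,
    |F k p.1 p.2 - F l p.1 p.2| ≤ κ) (isCompact_Icc.prod hS) ⟨0, by simp⟩ ?_ ?_ ?_
  · rintro s t hst ⟨N, hN⟩
    exact ⟨N, fun k hk l hl p hp => hN k hk l hl p (hst hp)⟩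
  · rintro s t ⟨N, hN⟩ ⟨N', hN'⟩
    refine ⟨max N N', fun k hk l hl p hp => ?_⟩
    rcases hp with hp | hp
    · exact hN k (le_of_max_le_left hk) l (le_of_max_le_left hl) p hp
    · exact hN' k (le_of_max_le_right hk) l (le_of_max_le_right hl) p hp
  rintro ⟨t₀, x₀⟩ ⟨ht₀, -⟩
  simp only at ht₀
  -- With these choices the oscillation is at most `κ/8` over times within `2h` and at most `κ/8`
  -- over the ball of radius `r`. The added ones keep the denominators positive.
  set h : ℝ := κ ^ 2 / (128 * (A + 1))
  have hh : 0 < h := by positivity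
  set r : ℝ := κ / (8 * (L + 1))
  have hr : 0 < r := by positivity
  set a := max (t₀ - h) 0
  set b := min (t₀ + h) T
  have hab : a < b := by
    refine max_lt (lt_min ?_ ?_) (lt_min ?_ ?_) <;> linarith [ht₀.1, ht₀.2]
  have hI : Icc (t₀ - h) (t₀ + h) ∩ Icc 0 T = Icc a b := Icc_inter_Icc
  have hIT : Icc a b ⊆ Icc 0 T := hI ▸ inter_subset_right
  have hba : b - a ≤ 2 * h := by
    have h1 : t₀ - h ≤ a := le_max_left _ _
    have h2 : b ≤ t₀ + h := min_le_left _ _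
    linarith
  have hclose : ∀ k, ∀ t ∈ Icc a b, ∀ s ∈ Icc a b, ∀ x ∈ Metric.ball x₀ r,
      |F k t x - F k s x₀| ≤ κ / 4 := by
    intro k t hta s hsa x hxr
    have h1 : |F k t x - F k t x₀| ≤ κ / 8 := by
      refine (hx k t x x₀).trans ?_
      calc (L : ℝ) * dist x x₀ ≤ (L + 1) * r := by
            have := (Metric.mem_ball.1 hxr).le
            gcongr
            linarith
        _ = κ / 8 := by simp only [r]; field_simp
    have h2 : |F k t x₀ - F k s x₀| ≤ κ / 8 := by
      refine abs_le_of_sq_le_sq ?_ (by positivity)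
      refine (ht k s (hIT hsa) t (hIT hta) x₀).trans ?_
      have h3 : |t - s| ≤ 2 * h := by
        rw [abs_le]
        constructor <;> linarith [hta.1, hta.2, hsa.1, hsa.2]
      calc A * |t - s| ≤ (A + 1) * (2 * h) := by
            gcongr
            linarith
        _ = (κ / 8) ^ 2 := by simp only [h]; field_simp; norm_num
    calc |F k t x - F k s x₀| ≤ |F k t x - F k t x₀| + |F k t x₀ - F k s x₀| :=
          abs_sub_le _ _ _
      _ ≤ κ / 4 := by linarith
  have havg : ∀ k, ∀ t ∈ Icc a b, ∀ x ∈ Metric.ball x₀ r,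
      |(b - a) * F k t x - ∫ s in Icc a b, F k s x₀| ≤ κ / 4 * (b - a) := by
    intro k t hta x hxr
    have h1 : (b - a) * F k t x = ∫ s in Icc a b, F k t x := by
      simp [hab.le]
    rw [h1, ← integral_sub (by simp) ((hint k x₀).mono_set hIT), ← Real.norm_eq_abs]
    have h2 := norm_setIntegral_le_of_norm_le_const (μ := volume) (s := Icc a b)
      (f := fun s => F k t x - F k s x₀) (C := κ / 4) (by simp)
      (fun s hs => hclose k t hta s hs x hxr)
    simpa [hab.le] using h2
  -- Replacing each of the two values by its time average costs `κ/4`, and the averages differ by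
  -- less than `κ/4`, for a total below `κ`.
  obtain ⟨N, hN⟩ := Metric.cauchySeq_iff.1 (hcau (t₀ - h) (t₀ + h) x₀) (κ / 4 * (b - a))
    (mul_pos (by positivity) (sub_pos.2 hab))
  refine ⟨(Icc (t₀ - h) (t₀ + h) ∩ Icc 0 T) ×ˢ Metric.ball x₀ r, ?_, N, ?_⟩
  · have h1 : Icc (t₀ - h) (t₀ + h) ×ˢ Metric.ball x₀ r ∈ 𝓝 (t₀, x₀) :=
      prod_mem_nhds (Icc_mem_nhds (by linarith) (by linarith)) (Metric.ball_mem_nhds _ hr)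
    filter_upwards [mem_nhdsWithin_of_mem_nhds h1, self_mem_nhdsWithin] with p hp hp'
    exact ⟨⟨hp.1, hp'.1⟩, hp.2⟩
  · rintro k hk l hl ⟨t, x⟩ ⟨hta, hxr⟩
    rw [hI] at hta
    have h1 := havg k t hta x hxr
    have h2 := havg l t hta x hxr
    have h3 := (hN k hk l hl).le
    rw [hI, Real.dist_eq] at h3
    have h4 : (b - a) * |F k t x - F l t x| ≤ (b - a) * κ := by
      rw [← abs_of_pos (sub_pos.2 hab), ← abs_mul, abs_of_pos (sub_pos.2 hab)]
      have hpos : 0 < (b - a) * κ := mul_pos (sub_pos.2 hab) hκ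
      rw [abs_le] at h1 h2 h3 ⊢
      constructor <;> linarith [h1.1, h1.2, h2.1, h2.2, h3.1, h3.2]
    exact le_of_mul_le_mul_left h4 (sub_pos.2 hab)

/-! ### Weak convergence and mollifiers -/

/-- Uniform boundedness principle applied in the bidual, into which the space embeds isometrically.
-/
theorem WeaklyConvergesTo.exists_norm_le {X : Type} [NormedAddCommGroup X] [NormedSpace ℝ X]
    {u : ℕ → X} {v : X} (h : WeaklyConvergesTo u v) : ∃ M, ∀ k, ‖u k‖ ≤ M := by
  obtain ⟨M, hM⟩ := banach_steinhaus (g := fun k => NormedSpace.inclusionInDoubleDual ℝ X (u k))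
    fun l => by
      obtain ⟨C, hC⟩ := ((h l).norm.bddAbove_range)
      exact ⟨C, fun k => hC ⟨k, rfl⟩⟩
  refine ⟨M, fun k => ?_⟩
  rw [← (NormedSpace.inclusionInDoubleDualLi ℝ (E := X)).norm_map (u k)]
  exact hM k

/-- A strong limit of the images is also their weak limit, and functionals separate points. -/
theorem WeaklyConvergesTo.tendsto_of_cauchySeq {X Y : Type} [NormedAddCommGroup X]
    [NormedSpace ℝ X] [NormedAddCommGroup Y] [NormedSpace ℝ Y] [CompleteSpace Y]
    {u : ℕ → X} {v : X} (h : WeaklyConvergesTo u v) (J : X →L[ℝ] Y)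
    (hc : CauchySeq fun k => J (u k)) : Tendsto (fun k => J (u k)) atTop (𝓝 (J v)) := by
  obtain ⟨y, hy⟩ := cauchySeq_tendsto_of_complete hc
  have hyv : y = J v := by
    refine (SeparatingDual.eq_iff_forall_dual_eq (R := ℝ)).2 fun l => ?_
    exact tendsto_nhds_unique ((l.continuous.tendsto y).comp hy) (h (l.comp J))
  exact hyv ▸ hy

/-- Mollifiers supported in the ball of radius `δ`. -/
theorem exists_lipschitz_mollifier (d : ℕ) {δ : ℝ} (hδ : 0 < δ) :
    ∃ (η : Rd d → ℝ) (L : NNReal) (B : ℝ), L ≠ 0 ∧ LipschitzWith L η ∧ (∀ x, |η x| ≤ B) ∧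
      (∀ x, 0 ≤ η x) ∧ HasCompactSupport η ∧ ∫ x, η x = 1 ∧ ∀ x, η x ≠ 0 → ‖x‖ ≤ δ := by
  let b : ContDiffBump (0 : Rd d) := ⟨δ / 2, δ, by positivity, by linarith⟩
  have hc : HasCompactSupport (b.normed volume) := b.hasCompactSupport_normed
  have hd : ContDiff ℝ 1 (b.normed volume) := b.contDiff_normed
  obtain ⟨L, hL⟩ := hd.lipschitzWith_of_hasCompactSupport hc one_ne_zero
  obtain ⟨B, hB⟩ := hc.exists_bound_of_continuous hd.continuous
  -- The Lipschitz constant is enlarged by one so that it is nonzero.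
  refine ⟨b.normed volume, L + 1, B, by positivity, hL.weaken le_self_add, hB,
    b.nonneg_normed, hc, b.integral_normed, fun x hx => ?_⟩
  have h : x ∈ Function.support (b.normed volume) := hx
  rw [b.support_normed_eq] at h
  simpa using (mem_ball_zero_iff.1 h).le

theorem mollify_sub {d : ℕ} {η f₁ f₂ : Rd d → ℝ} (x : Rd d)
    (h₁ : Integrable fun y => η (x - y) * f₁ y) (h₂ : Integrable fun y => η (x - y) * f₂ y) :
    mollify η (fun y => f₁ y - f₂ y) x = mollify η f₁ x - mollify η f₂ x := by
  simp only [mollify, mul_sub]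
  exact integral_sub h₁ h₂

/-- Evaluating a mollification at a point is a continuous linear functional on `L²`, hence
accessible to weak convergence. -/
theorem inner_toLp_eq_mollify {d : ℕ} {u : L2Rd d} {f η : Rd d → ℝ} (huf : u =ᵐ[volume] f)
    (x : Rd d) (hm : MemLp (fun y => η (x - y)) 2 volume) :
    inner ℝ (hm.toLp _) u = mollify η f x := by
  rw [L2.inner_def]
  refine integral_congr_ae ?_
  filter_upwards [huf, hm.coeFn_toLp] with y hy hy'
  rw [hy, hy']
  simp [mul_comm]

/-! ### Mollification and norms in the Bochner spaces -/

section time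

variable {d : ℕ} {T : ℝ}

theorem coeFn_L2Time_toL2 (u : L2Time T (H1 d)) :
    ∀ᵐ t ∂((volume : Measure ℝ).restrict (Icc 0 T)), L2Time.toL2 d T u t = H1.toL2 d (u t) :=
  (H1.toL2 d).coeFn_compLp u

theorem L2Time.IsClassOf.inner_eq_mollify {u : L2Time T (H1 d)} {w : ℝ → Rd d → ℝ}
    (hu : u.IsClassOf w) {η : Rd d → ℝ} (x : Rd d) (hm : MemLp (fun y => η (x - y)) 2 volume) :
    ∀ᵐ t ∂((volume : Measure ℝ).restrict (Icc 0 T)),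
      inner ℝ (hm.toLp _) (L2Time.toL2 d T u t) = mollify η (w t) x := by
  filter_upwards [hu, coeFn_L2Time_toL2 u] with t ht ht'
  rw [ht']
  exact inner_toLp_eq_mollify ht x hm

theorem L2Time.IsClassOf.integrableOn_mollify {u : L2Time T (H1 d)} {w : ℝ → Rd d → ℝ}
    (hu : u.IsClassOf w) {η : Rd d → ℝ} (x : Rd d) (hm : MemLp (fun y => η (x - y)) 2 volume) :
    IntegrableOn (fun t => mollify η (w t) x) (Icc 0 T) := by
  have h : MemLp (fun t => inner ℝ (hm.toLp _) (L2Time.toL2 d T u t)) 2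
      ((volume : Measure ℝ).restrict (Icc 0 T)) := (Lp.memLp _).const_inner _
  exact (h.integrable (by norm_num)).congr (hu.inner_eq_mollify x hm)

/-- Time averages of mollifications pass to the limit under weak convergence. -/
theorem cauchySeq_integral_mollify {u : ℕ → L2Time T (H1 d)} {v : L2Time T (H1 d)}
    (hv : WeaklyConvergesTo u v) {w : ℕ → ℝ → Rd d → ℝ} (hu : ∀ k, (u k).IsClassOf (w k))
    {η : Rd d → ℝ} (x : Rd d) (hm : MemLp (fun y => η (x - y)) 2 volume) (a b : ℝ) :
    CauchySeq fun k => ∫ t in Icc a b ∩ Icc 0 T, mollify η (w k t) x := by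
  have hfin : ((volume : Measure ℝ).restrict (Icc 0 T)) (Icc a b) ≠ ⊤ := measure_ne_top _ _
  -- The functional pairs with the element `1_[a,b](t) η(x - ·)` of `L²([0,T]; L²)`.
  have h := hv ((innerSL ℝ (indicatorConstLp 2 measurableSet_Icc hfin (hm.toLp _))).comp
    (L2Time.toL2 d T))
  refine Tendsto.cauchySeq (x := _) (h.congr fun k => ?_)
  simp only [ContinuousLinearMap.comp_apply, innerSL_apply_apply]
  rw [L2.inner_indicatorConstLp_eq_setIntegral_inner, Measure.restrict_restrict measurableSet_Icc]
  refine integral_congr_ae ?_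
  exact ae_mono (Measure.restrict_mono inter_subset_right le_rfl)
    ((hu k).inner_eq_mollify x hm)

theorem H1.norm_sq_eq (p : H1 d) :
    ‖p‖ ^ 2 = ‖H1.toL2 d p‖ ^ 2 + ‖(p : WithLp 2 (L2Rd d × L2RdVec d)).snd‖ ^ 2 :=
  WithLp.prod_norm_sq_eq_of_L2 (p : WithLp 2 (L2Rd d × L2RdVec d))

theorem norm_sq_Lp_eq_integral {X : Type} [NormedAddCommGroup X] [InnerProductSpace ℝ X]
    (u : L2Time T X) :
    ‖u‖ ^ 2 = ∫ t, ‖u t‖ ^ 2 ∂((volume : Measure ℝ).restrict (Icc 0 T)) := by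
  rw [← real_inner_self_eq_norm_sq, L2.inner_def]
  simp only [real_inner_self_eq_norm_sq]

/-- Integrating a pointwise-in-time interpolation estimate. -/
theorem norm_sq_toL2_le (hT : 0 ≤ T) (u : L2Time T (H1 d)) {δ c : ℝ}
    (h : ∀ᵐ t ∂((volume : Measure ℝ).restrict (Icc 0 T)),
      ‖H1.toL2 d (u t)‖ ^ 2 ≤ δ * ‖u t‖ ^ 2 + c) :
    ‖L2Time.toL2 d T u‖ ^ 2 ≤ δ * ‖u‖ ^ 2 + T * c := by
  have hi : ∀ {X : Type} [NormedAddCommGroup X] (u : L2Time T X),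
      Integrable (fun t => ‖u t‖ ^ 2) ((volume : Measure ℝ).restrict (Icc 0 T)) := fun u =>
    (memLp_two_iff_integrable_sq_norm (Lp.aestronglyMeasurable u)).1 (Lp.memLp u)
  have hc : ∫ _ : ℝ, c ∂((volume : Measure ℝ).restrict (Icc 0 T)) = T * c := by
    simp [hT]
  rw [norm_sq_Lp_eq_integral, norm_sq_Lp_eq_integral u, ← hc, ← integral_const_mul,
    ← integral_add ((hi u).const_mul _) (integrable_const _)]
  refine integral_mono_ae (hi _) (((hi u).const_mul _).add (integrable_const _)) ?_
  filter_upwards [h, coeFn_L2Time_toL2 u] with t ht ht'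
  rw [ht']
  exact ht

end time

/-! ### Uniform moments and conclusion -/

/-- The bound adds the first moment of the datum, the growth allowed by the Hölder estimate up to
time `T`, and the first moment of the kernel, which rescaling by `ε ≤ 1` does not increase. -/
theorem AdmissibleKernel.exists_integral_min_norm_mul_convMeasure_le {d : ℕ} {T : ℝ}
    {V : Rd d → ℝ} (hV : AdmissibleKernel V) {ρ₀ : ProbabilityMeasure (Rd d)}
    (hρ₀ : AdmissibleDatum ρ₀) {ρ : ℝ → ℝ → ProbabilityMeasure (Rd d)}
    (hρ : ∀ ε ∈ Ioc (0 : ℝ) 1, IsJKOLimit V ε T ρ₀ (ρ ε)) :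
    ∃ M : ℝ, 0 ≤ M ∧ ∀ ε ∈ Ioc (0 : ℝ) 1, ∀ t ∈ Icc 0 T, ∀ R, 0 ≤ R →
      ∫ x, min ‖x‖ R * convMeasure (rescale V ε) (ρ ε t) x ≤ M := by
  obtain ⟨E, hE⟩ := hV.exists_interactionEnergy_le hρ₀
  refine ⟨∫ x, ‖x‖ ∂(ρ₀ : Measure (Rd d)) + √(2 * E * T) + ∫ x, ‖x‖ * V x, ?_, ?_⟩
  · have h1 : 0 ≤ ∫ x, ‖x‖ ∂(ρ₀ : Measure (Rd d)) := integral_nonneg fun _ => norm_nonneg _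
    have h2 : 0 ≤ ∫ x, ‖x‖ * V x := integral_nonneg fun x => mul_nonneg (norm_nonneg _) (hV.nonneg x)
    positivity
  intro ε hε t ht R hR
  refine ((hV.isKernelDensity_rescale hε.1).integral_min_mul_convMeasure_le (ρ ε t)
    (hV.integrable_norm_mul_rescale hε.1) hR).trans ?_
  refine add_le_add (((hρ ε hε).integral_min_norm_le hρ₀.mem_P2 hV.nonneg hε.1 ht hR).trans ?_)
    (hV.integral_norm_mul_rescale_le hε)
  have hT : 0 ≤ T := ht.1.trans ht.2
  gcongr
  exact hE ε hε

theorem proposition4p6 {d : ℕ} (hd : 1 ≤ d) {T : ℝ} (hT : 0 < T)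
    {V : Rd d → ℝ} (hV : AdmissibleKernel V)
    {ρ₀ : ProbabilityMeasure (Rd d)} (hρ₀ : AdmissibleDatum ρ₀)
    (ρ : ℝ → ℝ → ProbabilityMeasure (Rd d))
    (hρ : ∀ ε ∈ Ioc (0 : ℝ) 1, IsJKOLimit V ε T ρ₀ (ρ ε))
    (ε : ℕ → ℝ) (hε : ∀ k, ε k ∈ Ioc (0 : ℝ) 1)
    (vε : ℕ → L2Time T (H1 d))
    (hvε : ∀ k, (vε k).IsClassOf fun t => convMeasure (rescale V (ε k)) (ρ (ε k) t))
    (v : L2Time T (H1 d)) (hv : WeaklyConvergesTo vε v) :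
    Tendsto (fun k => L2Time.toL2 d T (vε k)) atTop (𝓝 (L2Time.toL2 d T v)) := by
  refine hv.tendsto_of_cauchySeq (L2Time.toL2 d T) (Metric.cauchySeq_iff.2 fun r hr => ?_)
  obtain ⟨M, hM⟩ := hv.exists_norm_le
  have hM0 : 0 ≤ M := (norm_nonneg (vε 0)).trans (hM 0)
  obtain ⟨E, hE⟩ := hV.exists_interactionEnergy_le hρ₀
  obtain ⟨M₁, hM₁0, hM₁⟩ := hV.exists_integral_min_norm_mul_convMeasure_le hρ₀ hρ
  -- The parameters share out `r²`: the gradient term is at most `r²/4` since differences have norm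
  -- at most `2M`; the local term `2κT` is `r²/8`, and the tail is at most `r²/8` by the choice of
  -- `R`. The sum is at most `r²/2`.
  set δ : ℝ := r ^ 2 / (4 * (2 * M + 1) ^ 2)
  have hδ : 0 < δ := by positivity
  obtain ⟨η, L, B, hL0, hL, hB, hη0, hηc, hη1, hηδ⟩ := exists_lipschitz_mollifier d hδ
  have hB0 : 0 ≤ B := (abs_nonneg _).trans (hB 0)
  set κ : ℝ := r ^ 2 / (16 * T)
  have hκ : 0 < κ := by positivity
  set R : ℝ := 32 * T * (B * M₁ + 1) / r ^ 2
  have hR : 0 < R := by positivity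
  have hK : ∀ k, IsKernelDensity (rescale V (ε k)) := fun k =>
    hV.isKernelDensity_rescale (hε k).1
  have hm : ∀ x, MemLp (fun y => η (x - y)) 2 volume := fun x =>
    (hL.continuous.comp (continuous_const.sub continuous_id)).memLp_of_hasCompactSupport
      (hηc.comp_homeomorph (Homeomorph.subLeft x))
  have hE0 : 0 ≤ E := (interactionEnergy_nonneg hV.nonneg one_pos ρ₀).trans (hE 1 (by simp))
  obtain ⟨N, hN⟩ := exists_forall_abs_sub_le_of_cauchySeq_average hT
    (F := fun k t x => mollify η (convMeasure (rescale V (ε k)) (ρ (ε k) t)) x) (L := L)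
    (A := 2 * L ^ 2 * E) (by positivity)
    (fun k t x x' => abs_mollify_convMeasure_sub_le (hK k) hL hB _ x x')
    (fun k s hs t ht x => (sq_mollify_convMeasure_sub_le (hK k) hL hB hL0 (hρ _ (hε k))
      hρ₀.mem_P2 hV.nonneg (hε k).1 hs ht x).trans (by gcongr; exact hE _ (hε k)))
    (fun k x => (hvε k).integrableOn_mollify x (hm x))
    (fun a b x => cauchySeq_integral_mollify hv hvε x (hm x) a b)
    (isCompact_closedBall (0 : Rd d) R) hκ
  refine ⟨N, fun k hk l hl => ?_⟩
  rw [dist_eq_norm, ← map_sub]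
  have hpt : ∀ᵐ t ∂((volume : Measure ℝ).restrict (Icc 0 T)),
      ‖H1.toL2 d ((vε k - vε l) t)‖ ^ 2
        ≤ δ * ‖(vε k - vε l) t‖ ^ 2 + (2 * κ + 2 * (2 * B) * M₁ / R) := by
    filter_upwards [hvε k, hvε l, Lp.coeFn_sub (vε k) (vε l),
      ae_restrict_mem measurableSet_Icc] with t hkt hlt hsub ht
    set p := (vε k - vε l) t
    set f₁ := convMeasure (rescale V (ε k)) (ρ (ε k) t)
    set f₂ := convMeasure (rescale V (ε l)) (ρ (ε l) t)
    have hpf : H1.toL2 d p =ᵐ[volume] fun x => f₁ x - f₂ x := by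
      have h1 : H1.toL2 d p = H1.toL2 d (vε k t) - H1.toL2 d (vε l t) := by
        rw [hsub, Pi.sub_apply, map_sub]
      rw [h1]
      filter_upwards [Lp.coeFn_sub (H1.toL2 d (vε k t)) (H1.toL2 d (vε l t)), hkt, hlt]
        with x h2 h3 h4
      rw [h2, Pi.sub_apply, h3, h4]
    have hi₁ : Integrable f₁ := (hK k).integrable_convMeasure _
    have hi₂ : Integrable f₂ := (hK l).integrable_convMeasure _
    obtain ⟨B₁, hB₁⟩ := (hK k).bounded_convMeasure (ρ (ε k) t)
    obtain ⟨B₂, hB₂⟩ := (hK l).bounded_convMeasure (ρ (ε l) t)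
    have hsplit := HasWeakGradient.norm_sq_le_mollify (u := H1.toL2 d p)
      (g := (p : WithLp 2 (L2Rd d × L2RdVec d)).snd) p.2 hpf
      (((hK k).continuous_convMeasure _).sub ((hK l).continuous_convMeasure _))
      ⟨B₁ + B₂, fun x => (abs_sub _ _).trans (add_le_add (hB₁ x) (hB₂ x))⟩ (hi₁.sub hi₂) hη0
      (hL.continuous.integrable_of_hasCompactSupport hηc) hη1 hηδ
    have hmi : ∀ i x, Integrable fun y =>
        η (x - y) * convMeasure (rescale V (ε i)) (ρ (ε i) t) y := fun i x =>
      (hK i).integrable_mul_convMeasure _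
        (hL.continuous.comp (continuous_const.sub continuous_id)) ⟨B, fun y => hB _⟩
    have hw : ∀ x, mollify η (fun y => f₁ y - f₂ y) x = mollify η f₁ x - mollify η f₂ x :=
      fun x => mollify_sub x (hmi k x) (hmi l x)
    have htail := integral_abs_mul_abs_le (w := mollify η fun y => f₁ y - f₂ y)
      ((hK k).convMeasure_nonneg (ρ (ε k) t)) ((hK l).convMeasure_nonneg (ρ (ε l) t)) hi₁ hi₂
      ((hK k).integral_convMeasure _) ((hK l).integral_convMeasure _) hR
      (hM₁ _ (hε k) t ht R hR.le) (hM₁ _ (hε l) t ht R hR.le) hκ.le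
      (fun x hx => by
        rw [hw]
        exact hN k hk l hl t ht x (mem_closedBall_zero_iff.2 hx))
      (B := 2 * B) (by positivity)
      (fun x => by
        rw [hw, two_mul]
        exact (abs_sub _ _).trans (add_le_add (abs_mollify_convMeasure_le (hK k) hB _ x)
          (abs_mollify_convMeasure_le (hK l) hB _ x)))
    -- The product of the two components is dominated by the squared `H¹` norm, whose time integral
    -- is bounded.
    have hamgm : ‖(p : WithLp 2 (L2Rd d × L2RdVec d)).snd‖ * ‖H1.toL2 d p‖ ≤ ‖p‖ ^ 2 := by
      rw [H1.norm_sq_eq]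
      nlinarith [sq_nonneg (‖(p : WithLp 2 (L2Rd d × L2RdVec d)).snd‖ - ‖H1.toL2 d p‖),
        sq_nonneg ‖H1.toL2 d p‖, sq_nonneg ‖(p : WithLp 2 (L2Rd d × L2RdVec d)).snd‖]
    exact hsplit.trans (add_le_add (mul_le_mul_of_nonneg_left hamgm hδ.le) htail)
  have hfin := norm_sq_toL2_le hT.le (vε k - vε l) hpt
  have hnorm : ‖vε k - vε l‖ ^ 2 ≤ (2 * M + 1) ^ 2 := by
    refine pow_le_pow_left₀ (norm_nonneg (vε k - vε l)) ?_ 2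
    linarith [hM k, hM l, norm_sub_le (vε k) (vε l)]
  have h1 : δ * ‖vε k - vε l‖ ^ 2 ≤ r ^ 2 / 4 := by
    calc δ * ‖vε k - vε l‖ ^ 2 ≤ δ * (2 * M + 1) ^ 2 := by gcongr
      _ = r ^ 2 / 4 := by simp only [δ]; field_simp
  have h2 : T * (2 * κ) = r ^ 2 / 8 := by simp only [κ]; field_simp; norm_num
  have h3 : T * (2 * (2 * B) * M₁ / R) ≤ r ^ 2 / 8 := by
    have h4 : T * (2 * (2 * B) * M₁ / R) = r ^ 2 / 8 * (B * M₁ / (B * M₁ + 1)) := by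
      simp only [R]; field_simp; ring
    rw [h4]
    refine mul_le_of_le_one_right (by positivity) ?_
    rw [div_le_one (by positivity)]
    linarith
  refine lt_of_pow_lt_pow_left₀ 2 hr.le ?_
  have hr2 : 0 < r ^ 2 := by positivity
  rw [mul_add] at hfin
  linarith
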